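/- Let $d_{\rm in},d,d_{\rm out},n,k\ge 1$ and $T\ge 0$ be integers, $\lambda>0$, $\kappa=2$. Write $|\cdot|$ for Euclidean norms and $\|\cdot\|_F$ for the Frobenius norm of matrices. Let $\rho$ be a probability measure on $\mathbb{R}^{d_{\rm in}}\times\mathbb{R}^{d_{\rm out}}$ with support contained in $\{(x,y):\max(|x|,|y|)\le 1\}$. Let $l:\mathbb{R}^{d_{\rm out}}\times\mathbb{R}^{d_{\rm out}}\to\mathbb{R}$ be ${\cal C}^1$ and $1$-Lipschitz in each of its two arguments, with $l(y,y)=0$ whenever $|y|\le 1$. Let $\sigma:\mathbb{R}\to\mathbb{R}$ be ${\cal C}^1$ and $1$-Lipschitz with $\sigma(0)=0$. For $v\in\mathbb{R}^{d_{\rm in}\times d}$ and $w\in\mathbb{R}^{d\times d_{\rm out}}$ let $f(x,v,w)=w^\top\sigma(v^\top x)$, where $\sigma$ is applied componentwise. For a batch $z=(x_i,y_i)_{1\le i\le k}$ let $$\mathcal{L}_k(z,v,w)=\frac1k\sum_{i=1}^k\Big(l(f(x_i,v,w),y_i)+\frac{\lambda}{2}\big(\|v\|_F^2+\|w\|_F^2\big)\Big).$$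 Let $\eta_V(t),\eta_W(t)$ satisfy $0\le\eta_W(t)\le\eta_V(t)\le 1/\lambda$ for $0\le t<T$. For each $0\le t<T$ let the training batch $Z^{(t)}=(X_i^{(t)},Y_i^{(t)})_{1\le i\le k}$ consist of independent random variables with law $\rho$. Given $(V(0),W(0))$, define for $0\le t<T$ $$V(t+1)=V(t)-\eta_V(t)\nabla_v\mathcal{L}_k(Z^{(t)},V(t),W(t)),\qquad W(t+1)=W(t)-\eta_W(t)\nabla_w\mathcal{L}_k(Z^{(t)},V(t),W(t)).$$ Let the test set $Z=(X_i,Y_i)_{1\le i\le n}$ consist of independent random variables with law $\rho$, and suppose that $Z$ is independent of the initialization $(V(0),W(0))$ and the training batches $(Z^{(t)})_{0\le t<T}$, taken jointly. Put $$\varepsilon_{\rm gen}(n,v,w)=\int l(f(x,v,w),y)\,\rho(dx,dy)-\frac1n\sum_{i=1}^n l(f(X_i,v,w),Y_i).$$ (a) Suppose that $W(0)=w$ is a deterministic matrix, that $\eta_W(t)=0$ for $0\le t<T$ (so that $W(t)=w$ for all $t\le T$), and that the entries of $V(0)$ are independent centered Gaussians with variance $\kappa/d$. Then for every $\zeta\in(0,1)$,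 $$\mathbb{P}\left(|\varepsilon_{\rm gen}(n,V(T),w)|\le(1+C_3(w,\zeta,T))\sqrt{\frac2n\log\frac4\zeta}\right)\ge 1-\zeta,$$ where $$C_3(w,\zeta,T)=\|w\|_F\left(\sqrt{d_{\rm in}}+\sqrt d+\sqrt{2\log\frac4\zeta}\right)\sqrt{\frac{\kappa}{d}}\prod_{t=0}^{T-1}(1-\eta_V(t)\lambda)+\frac{\|w\|_F^2}{\lambda}\left(1-\prod_{t=0}^{T-1}(1-\eta_V(t)\lambda)\right).$$ (b) Suppose that $\eta_W(t)=\eta_V(t)=:\eta(t)$ for $0\le t<T$, and that all the entries of $V(0)$ and $W(0)$ are independent centered Gaussians, with variance $\kappa/d$ for $V(0)$ and $\kappa/d_{\rm out}$ for $W(0)$. Then for every $\zeta\in(0,1)$, $$\mathbb{P}\left(|\varepsilon_{\rm gen}(n,V(T),W(T))|\le(1+C_5(\zeta,T))\sqrt{\frac2n\log\frac4\zeta}\right)\ge 1-\zeta,$$ where $$C_5(\zeta,T)=3\kappa\left(2+\frac{d_{\rm in}}{d}+\frac{d}{d_{\rm out}}+\Big(\frac2d+\frac2{d_{\rm out}}\Big)\log\frac8\zeta\right)\prod_{t=0}^{T-1}\big(1+(1-\lambda)\eta(t)\big)^2.$$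 -/

import Mathlib

open MeasureTheory ProbabilityTheory
open scoped NNReal Matrix

noncomputable section

namespace SGM

/-- Data points `(x, y)` in `ℝ^din × ℝ^dout`, both factors with the Euclidean norm. -/
abbrev Data (din dout : ℕ) : Type :=
  EuclideanSpace ℝ (Fin din) × EuclideanSpace ℝ (Fin dout)

/-- Loss functions `l : ℝ^dout × ℝ^dout → ℝ`, in curried form. -/
abbrev Loss (dout : ℕ) : Type :=
  EuclideanSpace ℝ (Fin dout) → EuclideanSpace ℝ (Fin dout) → ℝ

/-- The Frobenius norm of a real matrix. -/
def frob {m n : ℕ} (v : Matrix (Fin m) (Fin n) ℝ) : ℝ :=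
  Real.sqrt (∑ i, ∑ j, v i j ^ 2)

/-- The two-layer network `f(x, v, w) = wᵀ σ(vᵀ x)`, with `σ` applied componentwise. -/
def network {din d dout : ℕ} (σ : ℝ → ℝ) (x : EuclideanSpace ℝ (Fin din))
    (v : Matrix (Fin din) (Fin d) ℝ) (w : Matrix (Fin d) (Fin dout) ℝ) :
    EuclideanSpace ℝ (Fin dout) :=
  WithLp.toLp 2 (wᵀ *ᵥ fun j => σ ((vᵀ *ᵥ x.ofLp) j))

/-- The regularized loss `l(y₁, y₂) + (lam / 2) (‖v‖_F² + ‖w‖_F²)`. -/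
def regLoss {din d dout : ℕ} (l : Loss dout) (lam : ℝ)
    (y₁ y₂ : EuclideanSpace ℝ (Fin dout))
    (v : Matrix (Fin din) (Fin d) ℝ) (w : Matrix (Fin d) (Fin dout) ℝ) : ℝ :=
  l y₁ y₂ + lam / 2 * (frob v ^ 2 + frob w ^ 2)

/-- The regularized empirical loss of the parameters `(v, w)` on a batch `z` of size `k`. -/
def batchLoss {din d dout k : ℕ} (l : Loss dout) (σ : ℝ → ℝ) (lam : ℝ)
    (z : Fin k → Data din dout)
    (v : Matrix (Fin din) (Fin d) ℝ) (w : Matrix (Fin d) (Fin dout) ℝ) : ℝ :=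
  1 / (k : ℝ) * ∑ i, regLoss l lam (network σ (z i).1 v w) (z i).2 v w

/-- The gradient of a function of a matrix: the matrix of its partial derivatives with respect
to the entries. -/
def matGrad {m n : ℕ} (F : Matrix (Fin m) (Fin n) ℝ → ℝ) (v : Matrix (Fin m) (Fin n) ℝ) :
    Matrix (Fin m) (Fin n) ℝ :=
  Matrix.of fun i j => deriv (fun s : ℝ => F (v + s • Matrix.single i j (1 : ℝ))) 0

/-- The stochastic gradient iterates `(V(t), W(t))` started at `(v₀, w₀)`, with learning rates
`ηV`, `ηW`, the batch `z t` being used in the step from `t` to `t + 1`. -/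
def iterates {din d dout k : ℕ} (l : Loss dout) (σ : ℝ → ℝ) (lam : ℝ) (ηV ηW : ℕ → ℝ)
    (v₀ : Matrix (Fin din) (Fin d) ℝ) (w₀ : Matrix (Fin d) (Fin dout) ℝ)
    (z : ℕ → Fin k → Data din dout) :
    ℕ → Matrix (Fin din) (Fin d) ℝ × Matrix (Fin d) (Fin dout) ℝ
  | 0 => (v₀, w₀)
  | t + 1 =>
    let p := iterates l σ lam ηV ηW v₀ w₀ z t
    (p.1 - ηV t • matGrad (fun v => batchLoss l σ lam (z t) v p.2) p.1,
      p.2 - ηW t • matGrad (fun w => batchLoss l σ lam (z t) p.1 w) p.2)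

/-- The generalization error of the parameters `(v, w)`: the expected loss under `ρ` minus the
average loss over the sample `z` of size `n`. -/
def genError {din d dout n : ℕ} (ρ : Measure (Data din dout)) (l : Loss dout) (σ : ℝ → ℝ)
    (z : Fin n → Data din dout)
    (v : Matrix (Fin din) (Fin d) ℝ) (w : Matrix (Fin d) (Fin dout) ℝ) : ℝ :=
  (∫ p, l (network σ p.1 v w) p.2 ∂ρ)
    - 1 / (n : ℝ) * ∑ i, l (network σ (z i).1 v w) (z i).2

/-- The conditions on the loss: it is `C¹`, `1`-Lipschitz in each of its two arguments, and
vanishes at `(y, y)` for `|y| ≤ 1`. -/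
structure AdmissibleLoss {dout : ℕ} (l : Loss dout) : Prop where
  contDiff : ContDiff ℝ 1
    (fun p : EuclideanSpace ℝ (Fin dout) × EuclideanSpace ℝ (Fin dout) => l p.1 p.2)
  lipschitz_left : ∀ y₂, LipschitzWith 1 (fun y₁ => l y₁ y₂)
  lipschitz_right : ∀ y₁, LipschitzWith 1 (fun y₂ => l y₁ y₂)
  self_eq_zero : ∀ y, ‖y‖ ≤ 1 → l y y = 0

/-- The conditions on the activation function: it is `C¹`, `1`-Lipschitz and `σ 0 = 0`. -/
structure AdmissibleActivation (σ : ℝ → ℝ) : Prop where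
  contDiff : ContDiff ℝ 1 σ
  lipschitz : LipschitzWith 1 σ
  map_zero : σ 0 = 0

/-- `Z` is a finite family of independent random variables, each with law `ρ`. -/
structure IIDSample {Ω E : Type*} [MeasurableSpace Ω] [MeasurableSpace E] {n : ℕ}
    (P : Measure Ω) (ρ : Measure E) (Z : Fin n → Ω → E) : Prop where
  measurable : ∀ i, Measurable (Z i)
  law : ∀ i, P.map (Z i) = ρ
  indep : iIndepFun Z P

/-- `g` is a family of independent centered Gaussian variables, `g i` having variance `s i`. -/
structure IndepCenteredGaussians {Ω ι : Type*} [MeasurableSpace Ω]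
    (P : Measure Ω) (s : ι → ℝ≥0) (g : ι → Ω → ℝ) : Prop where
  measurable : ∀ i, Measurable (g i)
  law : ∀ i, P.map (g i) = gaussianReal 0 (s i)
  indep : iIndepFun g P

/-- The constant `κ = 2` of He initialization. -/
def kappa : ℝ≥0 := 2

/-- He initialization of the first layer: the entries of `V` are independent centered Gaussians
with variance `κ / d`. -/
def HeInitFirst {Ω : Type*} [MeasurableSpace Ω] {din d : ℕ} (P : Measure Ω)
    (V : Ω → Matrix (Fin din) (Fin d) ℝ) : Prop :=
  IndepCenteredGaussians P (fun _ : Fin din × Fin d => kappa / d) (fun q ω => V ω q.1 q.2)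

/-- He initialization of both layers: all entries of `V` and `W` together are independent
centered Gaussians, with variance `κ / d` for `V` and `κ / dout` for `W`. -/
def HeInit {Ω : Type*} [MeasurableSpace Ω] {din d dout : ℕ} (P : Measure Ω)
    (V : Ω → Matrix (Fin din) (Fin d) ℝ) (W : Ω → Matrix (Fin d) (Fin dout) ℝ) : Prop :=
  IndepCenteredGaussians P
    (Sum.elim (fun _ : Fin din × Fin d => kappa / (d : ℝ≥0))
      (fun _ : Fin d × Fin dout => kappa / (dout : ℝ≥0)))
    (Sum.elim (fun q ω => V ω q.1 q.2) (fun q ω => W ω q.1 q.2))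

/-- The constant of the bound for a frozen second layer `w`. -/
def C3 {d dout : ℕ} (din : ℕ) (lam : ℝ) (η : ℕ → ℝ) (w : Matrix (Fin d) (Fin dout) ℝ)
    (ζ : ℝ) (T : ℕ) : ℝ :=
  frob w * (Real.sqrt din + Real.sqrt d + Real.sqrt (2 * Real.log (4 / ζ)))
      * Real.sqrt (kappa / d) * ∏ t ∈ Finset.range T, (1 - η t * lam)
    + frob w ^ 2 / lam * (1 - ∏ t ∈ Finset.range T, (1 - η t * lam))

/-- The constant of the bound for equal learning rates. -/
def C5 (din d dout : ℕ) (lam : ℝ) (η : ℕ → ℝ) (ζ : ℝ) (T : ℕ) : ℝ :=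
  3 * (kappa : ℝ)
    * (2 + (din : ℝ) / d + (d : ℝ) / dout + (2 / (d : ℝ) + 2 / (dout : ℝ)) * Real.log (8 / ζ))
    * ∏ t ∈ Finset.range T, (1 + (1 - lam) * η t) ^ 2

end SGM

end

/-! ### Standard Gaussian measure, integration by parts, and an integrability class. -/

namespace SGM

/-! The test sample is independent of the trained parameters, so it suffices to apply Hoeffding's
inequality at fixed parameters and integrate over their law. Since `l y y = 0` on the unit ball and
all maps are Lipschitz, the loss at a data point of norm at most one is at most `1 + ‖v‖ * ‖w‖` in
absolute value, with operator norms. If `‖V(T)‖ * ‖W(T)‖ ≤ R` fails with probability at most `ζ /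
2`, and each Hoeffding tail costs `ζ / 4`, the bound with constant `1 + R` holds with probability at
least `1 - ζ`. This is `one_sub_le_prob_genError_le`.

It remains to bound the norms of the trained matrices. The data part of the gradient in `v` is an
average of rank-one matrices and has operator norm at most `‖w‖`; the one in `w` has norm at most
`‖v‖`. Together with weight decay this gives linear recursions for the norms, solved in
`norm_iterates_fst_le` and `norm_iterates_add_le`. Everything is thus reduced to the norms at
initialization.

The probabilistic core is `measure_l2_opNorm_gt_le`: an `n × m` standard Gaussian matrix has norm
above `√n + √m + s` with probability at most `exp (-s ^ 2 / 2)`. A Slepian comparison is carried out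
directly on exponential moments. For unit vectors, the process `⟨u, G v⟩` plus one independent
standard Gaussian has the same variances as `⟨g, u⟩ + ⟨h, v⟩` and no smaller covariances, so its
maximum has smaller exponential moments (`integral_softExpMax_comparison`). The second maximum is at
most `|g| + |h|`, whose exponential moment is at most `exp (θ (√n + √m) + θ ^ 2)` by
`integral_exp_sqrt_sum_sq_le`. The added Gaussian contributes a factor `exp (θ ^ 2 / 2)`, which is
divided out, and Markov's inequality at `θ = s` gives the tail. No separate concentration theorem is
needed. -/

/-- The standard Gaussian measure on `κ → ℝ`. -/
noncomputable def stdGauss (κ : Type*) [Fintype κ] : Measure (κ → ℝ) :=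
  Measure.pi fun _ => gaussianReal 0 1

instance (κ : Type*) [Fintype κ] : IsProbabilityMeasure (stdGauss κ) := by
  unfold stdGauss; infer_instance

/-- The density of the standard Gaussian measure on `κ → ℝ`. -/
noncomputable def stdGaussDensity (κ : Type*) [Fintype κ] (g : κ → ℝ) : ℝ :=
  ∏ a, gaussianPDFReal 0 1 (g a)

section Density

variable {κ : Type*} [Fintype κ]

lemma stdGaussDensity_nonneg (g : κ → ℝ) : 0 ≤ stdGaussDensity κ g :=
  Finset.prod_nonneg fun _ _ => gaussianPDFReal_nonneg _ _ _

lemma measurable_stdGaussDensity : Measurable (stdGaussDensity κ) :=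
  Finset.measurable_fun_prod _ fun a _ => (measurable_gaussianPDFReal 0 1).comp (measurable_pi_apply a)

/-- Integration by parts takes place against Lebesgue measure, so the product measure is rewritten
with a density. On boxes both the indicator and the density factor over the coordinates. -/
lemma stdGauss_eq_withDensity :
    stdGauss κ = volume.withDensity fun g => ENNReal.ofReal (stdGaussDensity κ g) := by
  refine Measure.pi_eq fun s hs => ?_
  have hS : MeasurableSet (Set.univ.pi s) := MeasurableSet.univ_pi hs
  rw [withDensity_apply _ hS, ← lintegral_indicator hS]
  have hfun : ∀ g : κ → ℝ, (Set.univ.pi s).indicator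
      (fun g => ENNReal.ofReal (stdGaussDensity κ g)) g =
      ENNReal.ofReal (∏ a, (s a).indicator (gaussianPDFReal 0 1) (g a)) := by
    intro g
    by_cases hg : g ∈ Set.univ.pi s
    · rw [Set.indicator_of_mem hg]
      congr 1
      exact Finset.prod_congr rfl fun a _ =>
        (Set.indicator_of_mem (hg a (Set.mem_univ a)) _).symm
    · rw [Set.indicator_of_notMem hg]
      simp only [Set.mem_pi, Set.mem_univ, true_implies, not_forall] at hg
      obtain ⟨a, ha⟩ := hg
      rw [Finset.prod_eq_zero (Finset.mem_univ a) (Set.indicator_of_notMem ha _),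
        ENNReal.ofReal_zero]
  have hint : ∀ a, Integrable ((s a).indicator (gaussianPDFReal 0 1)) := fun a =>
    (integrable_gaussianPDFReal 0 1).indicator (hs a)
  simp_rw [hfun]
  rw [volume_pi, ← ofReal_integral_eq_lintegral_ofReal (Integrable.fintype_prod hint)
    (Filter.Eventually.of_forall fun g => Finset.prod_nonneg fun a _ =>
      Set.indicator_nonneg (fun _ _ => gaussianPDFReal_nonneg _ _ _) _),
    integral_fintype_prod_eq_prod, ENNReal.ofReal_prod_of_nonneg]
  · refine Finset.prod_congr rfl fun a _ => ?_
    rw [gaussianReal_apply_eq_integral _ one_ne_zero, integral_indicator (hs a)]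
  · exact fun a _ => integral_nonneg fun x =>
      Set.indicator_nonneg (fun _ _ => gaussianPDFReal_nonneg _ _ _) _

lemma integrable_stdGauss_iff (h : (κ → ℝ) → ℝ) :
    Integrable h (stdGauss κ) ↔ Integrable fun g => h g * stdGaussDensity κ g := by
  rw [stdGauss_eq_withDensity, integrable_withDensity_iff_integrable_smul'
    measurable_stdGaussDensity.ennreal_ofReal (by simp)]
  simp [ENNReal.toReal_ofReal (stdGaussDensity_nonneg _), mul_comm]

lemma integral_stdGauss (h : (κ → ℝ) → ℝ) :
    ∫ g, h g ∂stdGauss κ = ∫ g, h g * stdGaussDensity κ g := by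
  rw [stdGauss_eq_withDensity, integral_withDensity_eq_integral_toReal_smul
    measurable_stdGaussDensity.ennreal_ofReal (by simp)]
  simp [ENNReal.toReal_ofReal (stdGaussDensity_nonneg _), mul_comm]

lemma stdGaussDensity_eq (g : κ → ℝ) :
    stdGaussDensity κ g = (√(2 * Real.pi))⁻¹ ^ Fintype.card κ * Real.exp (-(∑ a, g a ^ 2) / 2) := by
  simp only [stdGaussDensity, gaussianPDFReal, NNReal.coe_one, mul_one, sub_zero,
    Finset.prod_mul_distrib, Finset.prod_const, Finset.card_univ]
  rw [← Real.exp_sum, ← Finset.sum_div, Finset.sum_neg_distrib]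

lemma hasLineDerivAt_stdGaussDensity [DecidableEq κ] (g : κ → ℝ) (a : κ) :
    HasLineDerivAt ℝ (stdGaussDensity κ) (-(g a * stdGaussDensity κ g)) g (Pi.single a 1) := by
  unfold HasLineDerivAt
  simp only [stdGaussDensity_eq]
  have h1 : HasDerivAt (fun t : ℝ => ∑ b, (g + t • (Pi.single a (1 : ℝ) : κ → ℝ)) b ^ 2)
      (∑ b, 2 * g b * (Pi.single a (1 : ℝ) : κ → ℝ) b) 0 := by
    refine HasDerivAt.fun_sum fun b _ => ?_
    have : HasDerivAt (fun t : ℝ => (g + t • (Pi.single a (1 : ℝ) : κ → ℝ)) b)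
        ((Pi.single a (1 : ℝ) : κ → ℝ) b) 0 := by
      simpa using ((hasDerivAt_id (0 : ℝ)).mul_const
        ((Pi.single a (1 : ℝ) : κ → ℝ) b)).const_add (g b)
    simpa using this.fun_pow 2
  have h2 := ((h1.neg.div_const 2).exp).const_mul ((√(2 * Real.pi))⁻¹ ^ Fintype.card κ)
  convert! h2 using 1
  simp [Pi.single_apply]
  ring

/-- Gaussian integration by parts. -/
lemma integral_coord_mul_stdGauss [DecidableEq κ] {h h' : (κ → ℝ) → ℝ} (a : κ)
    (hh : ∀ g, HasLineDerivAt ℝ h (h' g) g (Pi.single a 1))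
    (hi : Integrable h (stdGauss κ)) (hi' : Integrable h' (stdGauss κ))
    (hia : Integrable (fun g => g a * h g) (stdGauss κ)) :
    ∫ g, g a * h g ∂stdGauss κ = ∫ g, h' g ∂stdGauss κ := by
  rw [integrable_stdGauss_iff] at hi hi' hia
  -- The density is differentiated instead of `h`; its derivative along coordinate `a` is `-g a`
  -- times itself.
  have key := integral_bilinear_hasLineDerivAt_right_eq_neg_left_of_integrable
    (μ := (volume : Measure (κ → ℝ))) (B := ContinuousLinearMap.mul ℝ ℝ) (f := h) (f' := h')
    (g := stdGaussDensity κ) (g' := fun g => -(g a * stdGaussDensity κ g)) (v := Pi.single a 1)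
    (by simpa using hi')
    (by simpa [mul_comm, mul_left_comm, mul_assoc] using hia.neg) (by simpa using hi)
    (fun g _ => hh g) (fun g _ => hasLineDerivAt_stdGaussDensity g a)
  simp only [ContinuousLinearMap.mul_apply'] at key
  rw [integral_stdGauss, integral_stdGauss, ← neg_neg (∫ g, h' g * stdGaussDensity κ g), ← key,
    ← integral_neg]
  congr 1
  ext g
  ring

end Density

/-- Continuous functions of at most exponential growth. -/
def ExpBounded {κ : Type*} [Fintype κ] (h : (κ → ℝ) → ℝ) : Prop :=
  Continuous h ∧ ∃ C c : ℝ, 0 ≤ C ∧ 0 ≤ c ∧ ∀ g, |h g| ≤ C * Real.exp (c * ∑ a, |g a|)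

namespace ExpBounded

variable {κ : Type*} [Fintype κ] {h h₁ h₂ : (κ → ℝ) → ℝ}

/-- The function is a product over coordinates, and in one variable `exp (c * |x|)` is at most `exp
(c * x) + exp (-c * x)`. Every integrability claim about `ExpBounded` functions rests on this. -/
lemma integrable_exp_sum_abs (c : ℝ) :
    Integrable (fun g : κ → ℝ => Real.exp (c * ∑ a, |g a|)) (stdGauss κ) := by
  have h1 : Integrable (fun x : ℝ => Real.exp (c * |x|)) (gaussianReal 0 1) := by
    refine ((integrable_exp_mul_gaussianReal (μ := 0) (v := 1) c).add
      (integrable_exp_mul_gaussianReal (μ := 0) (v := 1) (-c))).mono'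
      (by fun_prop) (Filter.Eventually.of_forall fun x => ?_)
    rw [Real.norm_eq_abs, abs_of_pos (Real.exp_pos _)]
    simp only [Pi.add_apply]
    rcases abs_choice x with hx | hx <;> rw [hx]
    · exact le_add_of_nonneg_right (Real.exp_pos _).le
    · rw [mul_neg, ← neg_mul]
      exact le_add_of_nonneg_left (Real.exp_pos _).le
  have := Integrable.fintype_prod (ι := κ) (f := fun _ x => Real.exp (c * |x|)) fun _ => h1
  simpa only [Finset.mul_sum, Real.exp_sum, stdGauss] using this

lemma integrable (hh : ExpBounded h) : Integrable h (stdGauss κ) := by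
  obtain ⟨hc, C, c, -, -, hb⟩ := hh
  exact ((integrable_exp_sum_abs c).const_mul C).mono' hc.aestronglyMeasurable
    (Filter.Eventually.of_forall hb)

lemma of_le (hc : Continuous h) {C c : ℝ} (hC : 0 ≤ C) (hc0 : 0 ≤ c)
    (hb : ∀ g, |h g| ≤ C * Real.exp (c * ∑ a, |g a|)) : ExpBounded h := ⟨hc, C, c, hC, hc0, hb⟩

lemma const (C : ℝ) : ExpBounded fun _ : κ → ℝ => C :=
  of_le continuous_const (abs_nonneg C) le_rfl fun g => by simp

lemma mul (h₁' : ExpBounded h₁) (h₂' : ExpBounded h₂) : ExpBounded fun g => h₁ g * h₂ g := by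
  obtain ⟨hc₁, C₁, c₁, hC₁, hc₁', hb₁⟩ := h₁'
  obtain ⟨hc₂, C₂, c₂, hC₂, hc₂', hb₂⟩ := h₂'
  refine of_le (hc₁.mul hc₂) (mul_nonneg hC₁ hC₂) (add_nonneg hc₁' hc₂') fun g => ?_
  rw [abs_mul, add_mul, Real.exp_add, mul_mul_mul_comm]
  exact mul_le_mul (hb₁ g) (hb₂ g) (abs_nonneg _) ((abs_nonneg _).trans (hb₁ g))

lemma add (h₁' : ExpBounded h₁) (h₂' : ExpBounded h₂) : ExpBounded fun g => h₁ g + h₂ g := by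
  obtain ⟨hc₁, C₁, c₁, hC₁, hc₁', hb₁⟩ := h₁'
  obtain ⟨hc₂, C₂, c₂, hC₂, hc₂', hb₂⟩ := h₂'
  refine of_le (hc₁.add hc₂) (add_nonneg hC₁ hC₂) (add_nonneg hc₁' hc₂') fun g => ?_
  have hs : 0 ≤ ∑ a, |g a| := Finset.sum_nonneg fun _ _ => abs_nonneg _
  rw [add_mul]
  refine (abs_add_le _ _).trans (add_le_add ((hb₁ g).trans ?_) ((hb₂ g).trans ?_))
  · gcongr; exact le_add_of_nonneg_right hc₂'
  · gcongr; exact le_add_of_nonneg_left hc₁'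

lemma sum {ι : Type*} (s : Finset ι) {f : ι → (κ → ℝ) → ℝ} (hf : ∀ i ∈ s, ExpBounded (f i)) :
    ExpBounded fun g => ∑ i ∈ s, f i g := by
  classical
  induction s using Finset.induction_on with
  | empty => simpa using const 0
  | insert i s hi ih =>
    simp only [Finset.sum_insert hi]
    exact (hf i (Finset.mem_insert_self i s)).add
      (ih fun j hj => hf j (Finset.mem_insert_of_mem hj))

lemma of_abs_le (hc : Continuous h₁) (h₂' : ExpBounded h₂) (hb : ∀ g, |h₁ g| ≤ |h₂ g|) :
    ExpBounded h₁ := by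
  obtain ⟨-, C, c, hC, hc', hb₂⟩ := h₂'
  exact of_le hc hC hc' fun g => (hb g).trans (hb₂ g)

lemma sum_abs : ExpBounded fun g : κ → ℝ => ∑ a, |g a| := by
  refine of_le (by fun_prop) zero_le_one zero_le_one fun g => ?_
  rw [abs_of_nonneg (Finset.sum_nonneg fun _ _ => abs_nonneg _), one_mul, one_mul]
  linarith [Real.add_one_le_exp (∑ a, |g a|)]

lemma exp_sum_abs {c : ℝ} (hc : 0 ≤ c) : ExpBounded fun g : κ → ℝ => Real.exp (c * ∑ a, |g a|) :=
  of_le (by fun_prop) zero_le_one hc fun g => by rw [Real.abs_exp, one_mul]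

lemma coord (a : κ) : ExpBounded fun g : κ → ℝ => g a :=
  of_abs_le (by fun_prop) sum_abs fun g => (Finset.single_le_sum (f := fun a => |g a|)
    (fun _ _ => abs_nonneg _) (Finset.mem_univ a)).trans (le_abs_self _)

end ExpBounded

end SGM

/-! ### Exponential moments of the norm of a Gaussian vector. -/

namespace SGM

section Chi

variable {κ : Type*} [Fintype κ]

lemma sum_sq_le_sum_abs_sq (g : κ → ℝ) : ∑ a, g a ^ 2 ≤ (∑ a, |g a|) ^ 2 := by
  have h : ∀ a, g a ^ 2 ≤ |g a| * ∑ b, |g b| := fun a => by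
    rw [← sq_abs, sq]
    exact mul_le_mul_of_nonneg_left (Finset.single_le_sum (f := fun b => |g b|)
      (fun _ _ => abs_nonneg _) (Finset.mem_univ a)) (abs_nonneg _)
  calc ∑ a, g a ^ 2 ≤ ∑ a, |g a| * ∑ b, |g b| := Finset.sum_le_sum fun a _ => h a
    _ = (∑ a, |g a|) ^ 2 := by rw [← Finset.sum_mul, sq]

/-- A smooth approximation of the Euclidean norm. -/
noncomputable def smoothNorm (ε : ℝ) (g : κ → ℝ) : ℝ := √(ε + ∑ a, g a ^ 2)

variable {ε : ℝ}

lemma continuous_smoothNorm : Continuous (smoothNorm ε : (κ → ℝ) → ℝ) := by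
  unfold smoothNorm; fun_prop

lemma smoothNorm_nonneg (g : κ → ℝ) : 0 ≤ smoothNorm ε g := Real.sqrt_nonneg _

lemma smoothNorm_le (hε : 0 < ε) (g : κ → ℝ) : smoothNorm ε g ≤ √ε + ∑ a, |g a| := by
  have h0 : 0 ≤ ∑ a, |g a| := Finset.sum_nonneg fun _ _ => abs_nonneg _
  refine Real.sqrt_le_iff.2 ⟨by positivity, ?_⟩
  nlinarith [Real.sq_sqrt hε.le, sum_sq_le_sum_abs_sq g, mul_nonneg (Real.sqrt_nonneg ε) h0]

lemma sq_smoothNorm (hε : 0 < ε) (g : κ → ℝ) : smoothNorm ε g ^ 2 = ε + ∑ a, g a ^ 2 :=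
  Real.sq_sqrt (add_nonneg hε.le (Finset.sum_nonneg fun _ _ => sq_nonneg _))

lemma smoothNorm_pos (hε : 0 < ε) (g : κ → ℝ) : 0 < smoothNorm ε g :=
  Real.sqrt_pos.2 (add_pos_of_pos_of_nonneg hε (Finset.sum_nonneg fun _ _ => sq_nonneg _))

lemma expBounded_smoothNorm (hε : 0 < ε) : ExpBounded (smoothNorm ε : (κ → ℝ) → ℝ) :=
  .of_abs_le continuous_smoothNorm ((ExpBounded.const (√ε)).add .sum_abs) fun g => by
    rw [abs_of_nonneg (smoothNorm_nonneg g)]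
    exact (smoothNorm_le hε g).trans (le_abs_self _)

lemma expBounded_exp_smoothNorm (hε : 0 < ε) (θ : ℝ) :
    ExpBounded fun g : κ → ℝ => Real.exp (θ * smoothNorm ε g) := by
  refine .of_abs_le (by have := continuous_smoothNorm (κ := κ) (ε := ε); fun_prop)
    ((ExpBounded.const (Real.exp (|θ| * √ε))).mul (.exp_sum_abs (abs_nonneg θ))) fun g => ?_
  rw [← Real.exp_add, Real.abs_exp, Real.abs_exp, Real.exp_le_exp, ← mul_add]
  exact (mul_le_mul_of_nonneg_right (le_abs_self θ) (smoothNorm_nonneg g)).trans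
    (mul_le_mul_of_nonneg_left (smoothNorm_le hε g) (abs_nonneg θ))

lemma hasLineDerivAt_coord_mul_exp_smoothNorm [DecidableEq κ] (hε : 0 < ε) (θ : ℝ) (a : κ)
    (g : κ → ℝ) :
    HasLineDerivAt ℝ (fun g : κ → ℝ => g a * Real.exp (θ * smoothNorm ε g))
      (Real.exp (θ * smoothNorm ε g)
        + θ * (g a ^ 2 / smoothNorm ε g * Real.exp (θ * smoothNorm ε g))) g (Pi.single a 1) := by
  unfold HasLineDerivAt
  have hb : ∀ b, HasDerivAt (fun t : ℝ => (g + t • (Pi.single a (1 : ℝ) : κ → ℝ)) b)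
        ((Pi.single a (1 : ℝ) : κ → ℝ) b) 0 := fun b => by
      simpa using ((hasDerivAt_id (0 : ℝ)).mul_const
        ((Pi.single a (1 : ℝ) : κ → ℝ) b)).const_add (g b)
  have h1 : HasDerivAt (fun t : ℝ => ε + ∑ b, (g + t • (Pi.single a (1 : ℝ) : κ → ℝ)) b ^ 2)
      (2 * g a) 0 := by
    have := (HasDerivAt.fun_sum (u := Finset.univ) fun b _ => (hb b).fun_pow 2).const_add ε
    simpa [Pi.single_apply] using this
  have h0 : ε + ∑ b, (g + (0 : ℝ) • (Pi.single a (1 : ℝ) : κ → ℝ)) b ^ 2 ≠ 0 := by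
    simpa using (add_pos_of_pos_of_nonneg hε (Finset.sum_nonneg fun _ _ => sq_nonneg _)).ne'
  have h2 := (hb a).mul ((h1.sqrt h0).const_mul θ).exp
  convert! h2 using 1
  have := (smoothNorm_pos hε g).ne'
  simp only [zero_smul, add_zero, Pi.single_eq_same, one_mul]
  change _ = Real.exp (θ * smoothNorm ε g)
    + g a * (Real.exp (θ * smoothNorm ε g) * (θ * (2 * g a / (2 * smoothNorm ε g))))
  field_simp

/-- The squared smooth norm is `ε + ∑ g a * g a`; one factor `g a` in each term is integrated by
parts. The derivative of the exponential produces `θ * ∑ g a ^ 2 / smoothNorm`, and this sum is at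
most `smoothNorm`. -/
lemma integral_sq_smoothNorm_mul_exp_le (hε : 0 < ε) {θ : ℝ} (hθ : 0 ≤ θ) :
    ∫ g : κ → ℝ, smoothNorm ε g ^ 2 * Real.exp (θ * smoothNorm ε g) ∂stdGauss κ ≤
      (Fintype.card κ + ε) * ∫ g : κ → ℝ, Real.exp (θ * smoothNorm ε g) ∂stdGauss κ
        + θ * ∫ g : κ → ℝ, smoothNorm ε g * Real.exp (θ * smoothNorm ε g) ∂stdGauss κ := by
  classical
  have hE := expBounded_exp_smoothNorm (κ := κ) hε θ
  have hr := expBounded_smoothNorm (κ := κ) hε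
  have hq : ∀ a, ExpBounded fun g : κ → ℝ => g a ^ 2 / smoothNorm ε g := fun a => by
    refine .of_abs_le ?_ hr fun g => ?_
    · exact Continuous.div (by fun_prop) continuous_smoothNorm fun g => (smoothNorm_pos hε g).ne'
    · rw [abs_of_nonneg (smoothNorm_nonneg g),
        abs_of_nonneg (div_nonneg (sq_nonneg _) (smoothNorm_nonneg g)),
        div_le_iff₀ (smoothNorm_pos hε g), ← sq, sq_smoothNorm hε]
      linarith [Finset.single_le_sum (f := fun b => g b ^ 2) (fun _ _ => sq_nonneg _)
        (Finset.mem_univ a)]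
  have hI : ∀ a, ∫ g : κ → ℝ, g a * (g a * Real.exp (θ * smoothNorm ε g)) ∂stdGauss κ =
      ∫ g : κ → ℝ, Real.exp (θ * smoothNorm ε g) ∂stdGauss κ
      + θ * ∫ g : κ → ℝ, g a ^ 2 / smoothNorm ε g * Real.exp (θ * smoothNorm ε g) ∂stdGauss κ := by
    intro a
    rw [integral_coord_mul_stdGauss a
      (hasLineDerivAt_coord_mul_exp_smoothNorm hε θ a) ((ExpBounded.coord a).mul hE).integrable
      (hE.add ((ExpBounded.const θ).mul ((hq a).mul hE))).integrable
      ((ExpBounded.coord a).mul ((ExpBounded.coord a).mul hE)).integrable,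
      integral_add hE.integrable ((ExpBounded.const θ).mul ((hq a).mul hE)).integrable,
      integral_const_mul]
  have h1 : ∫ g : κ → ℝ, smoothNorm ε g ^ 2 * Real.exp (θ * smoothNorm ε g) ∂stdGauss κ =
      ε * ∫ g : κ → ℝ, Real.exp (θ * smoothNorm ε g) ∂stdGauss κ +
      ∑ a, ∫ g : κ → ℝ, g a * (g a * Real.exp (θ * smoothNorm ε g)) ∂stdGauss κ := by
    rw [← integral_const_mul, ← integral_finsetSum _ fun a _ =>
      ((ExpBounded.coord a).mul ((ExpBounded.coord a).mul hE)).integrable,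
      ← integral_add ((ExpBounded.const ε).mul hE).integrable (ExpBounded.sum _ fun a _ =>
      (ExpBounded.coord a).mul ((ExpBounded.coord a).mul hE)).integrable]
    congr 1 with g
    rw [sq_smoothNorm hε, add_mul, Finset.sum_mul]
    congr 1
    exact Finset.sum_congr rfl fun a _ => by ring
  have h2 : ∑ a, ∫ g : κ → ℝ, g a ^ 2 / smoothNorm ε g * Real.exp (θ * smoothNorm ε g) ∂stdGauss κ
      ≤ ∫ g : κ → ℝ, smoothNorm ε g * Real.exp (θ * smoothNorm ε g) ∂stdGauss κ := by
    rw [← integral_finsetSum _ fun a _ => ((hq a).mul hE).integrable]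
    refine integral_mono (ExpBounded.sum _ fun a _ => (hq a).mul hE).integrable
      (hr.mul hE).integrable fun g => ?_
    simp only
    rw [← Finset.sum_mul, ← Finset.sum_div]
    gcongr
    rw [div_le_iff₀ (smoothNorm_pos hε g), ← sq, sq_smoothNorm hε]
    linarith
  rw [h1, Finset.sum_congr rfl fun a _ => hI a, Finset.sum_add_distrib, ← Finset.mul_sum,
    Finset.sum_const, Finset.card_univ, nsmul_eq_mul]
  linarith [mul_le_mul_of_nonneg_left h2 hθ]

/-- A differential inequality for the moment generating function `m`: integration by parts bounds
the second moment of the norm under the exponentially tilted law, so the tilted mean satisfies `m' /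
m ≤ θ + s`. Integrating from `m 0 = 1` gives the bound. -/
lemma integral_exp_smoothNorm_le (hε : 0 < ε) {θ : ℝ} (hθ : 0 ≤ θ) :
    ∫ g : κ → ℝ, Real.exp (θ * smoothNorm ε g) ∂stdGauss κ ≤
      Real.exp (θ * √(Fintype.card κ + ε) + θ ^ 2 / 2) := by
  set s := √(Fintype.card κ + ε) with hs
  have hs2 : s ^ 2 = Fintype.card κ + ε := Real.sq_sqrt (by positivity)
  have hs0 : 0 < s := Real.sqrt_pos.2 (by positivity)
  set m : ℝ → ℝ := fun θ => ∫ g : κ → ℝ, Real.exp (θ * smoothNorm ε g) ∂stdGauss κ with hm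
  set m' : ℝ → ℝ := fun θ =>
    ∫ g : κ → ℝ, smoothNorm ε g * Real.exp (θ * smoothNorm ε g) ∂stdGauss κ with hm'
  have hset : integrableExpSet (smoothNorm ε) (stdGauss κ) = Set.univ :=
    Set.eq_univ_of_forall fun t => (expBounded_exp_smoothNorm hε t).integrable
  have hd : ∀ t, HasDerivAt m (m' t) t := fun t => by
    have := hasDerivAt_mgf (X := smoothNorm ε) (μ := stdGauss κ) (t := t) (by simp [hset])
    exact this
  have hpos : ∀ t, 0 < m t := fun t => integral_exp_pos (expBounded_exp_smoothNorm hε t).integrable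
  have hle : ∀ t, 0 ≤ t → m' t ≤ (t + s) * m t := by
    intro t ht
    have hE := expBounded_exp_smoothNorm (κ := κ) hε t
    have hr := expBounded_smoothNorm (κ := κ) hε
    -- `q` is the mean of the smooth norm under the tilted law; `h0` says that its tilted variance
    -- is nonnegative.
    set q := m' t / m t with hq
    have hqm : m' t = q * m t := by rw [hq, div_mul_cancel₀ _ (hpos t).ne']
    have h0 : 0 ≤ ∫ g : κ → ℝ, (smoothNorm ε g - q) ^ 2 * Real.exp (t * smoothNorm ε g)
        ∂stdGauss κ := integral_nonneg fun g => by positivity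
    have h1 : ∫ g : κ → ℝ, (smoothNorm ε g - q) ^ 2 * Real.exp (t * smoothNorm ε g) ∂stdGauss κ =
        ∫ g : κ → ℝ, smoothNorm ε g ^ 2 * Real.exp (t * smoothNorm ε g) ∂stdGauss κ
        + ((-2 * q) * m' t + q ^ 2 * m t) := by
      have i1 : Integrable (fun g : κ → ℝ => smoothNorm ε g ^ 2 * Real.exp (t * smoothNorm ε g))
          (stdGauss κ) := by
        simpa only [sq] using ((hr.mul hr).mul hE).integrable
      simp only [hm, hm']
      rw [← integral_const_mul, ← integral_const_mul, ← integral_add, ← integral_add i1]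
      · congr 1 with g; ring
      · exact (((ExpBounded.const _).mul (hr.mul hE)).add ((ExpBounded.const _).mul hE)).integrable
      · exact ((ExpBounded.const _).mul (hr.mul hE)).integrable
      · exact ((ExpBounded.const _).mul hE).integrable
    have h2 := integral_sq_smoothNorm_mul_exp_le (κ := κ) hε ht
    have h3 : q ^ 2 * m t ≤ (s ^ 2 + t * q) * m t := by
      have h4 : 0 ≤ (s ^ 2 * m t + t * m' t) + ((-2 * q) * m' t + q ^ 2 * m t) := by
        rw [hs2]; linarith
      rw [hqm] at h4
      linarith
    have h5 : q ^ 2 ≤ s ^ 2 + t * q := le_of_mul_le_mul_right h3 (hpos t)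
    rw [hqm]
    refine mul_le_mul_of_nonneg_right ?_ (hpos t).le
    -- If `q > t + s`, then `q ^ 2 > t * q + s * q > t * q + s ^ 2`, against `h5`.
    by_contra! hc
    nlinarith
  -- Grönwall's argument: the exponent is an antiderivative of `-(s + t)`, so `F` does not increase
  -- and stays below `F 0 = 1`.
  set F : ℝ → ℝ := fun t => m t * Real.exp (-(t * s + t ^ 2 / 2)) with hF
  have hFd : ∀ t, HasDerivAt F (m' t * Real.exp (-(t * s + t ^ 2 / 2))
      + m t * (Real.exp (-(t * s + t ^ 2 / 2)) * (-(s + t)))) t := fun t => by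
    refine (hd t).mul (HasDerivAt.exp ?_)
    have := (((hasDerivAt_id t).mul_const s).add (((hasDerivAt_id t).fun_pow 2).div_const 2)).neg
    convert! this using 1
    simp
  have hanti : AntitoneOn F (Set.Ici 0) := by
    refine antitoneOn_of_deriv_nonpos (convex_Ici 0)
      (fun t _ => (hFd t).continuousAt.continuousWithinAt)
      (fun t _ => (hFd t).differentiableAt.differentiableWithinAt) fun t ht => ?_
    rw [interior_Ici, Set.mem_Ioi] at ht
    rw [(hFd t).deriv]
    have := mul_le_mul_of_nonneg_right (hle t ht.le) (Real.exp_pos (-(t * s + t ^ 2 / 2))).le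
    linarith
  have h0 : F 0 = 1 := by simp [hF, hm]
  have h1 := hanti Set.self_mem_Ici (Set.mem_Ici.2 hθ) hθ
  rw [h0, hF] at h1
  simp only [Real.exp_neg] at h1
  rwa [← div_eq_mul_inv, div_le_one (Real.exp_pos _)] at h1

/-- The exponential moments of the Euclidean norm of a standard Gaussian vector. -/
lemma integral_exp_sqrt_sum_sq_le {θ : ℝ} (hθ : 0 ≤ θ) :
    ∫ g : κ → ℝ, Real.exp (θ * √(∑ a, g a ^ 2)) ∂stdGauss κ ≤
      Real.exp (θ * √(Fintype.card κ) + θ ^ 2 / 2) := by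
  have hle : ∀ ε > 0, ∫ g : κ → ℝ, Real.exp (θ * √(∑ a, g a ^ 2)) ∂stdGauss κ ≤
      Real.exp (θ * √(Fintype.card κ + ε) + θ ^ 2 / 2) := fun ε hε => by
    refine le_trans ?_ (integral_exp_smoothNorm_le (κ := κ) hε hθ)
    refine integral_mono_of_nonneg (Filter.Eventually.of_forall fun g => (Real.exp_pos _).le)
      (expBounded_exp_smoothNorm hε θ).integrable (Filter.Eventually.of_forall fun g => ?_)
    refine Real.exp_le_exp.2 (mul_le_mul_of_nonneg_left (Real.sqrt_le_sqrt ?_) hθ)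
    linarith
  have hc : Continuous fun ε : ℝ => Real.exp (θ * √(Fintype.card κ + ε) + θ ^ 2 / 2) := by fun_prop
  have ht := (hc.tendsto 0).mono_left (nhdsWithin_le_nhds (s := Set.Ioi 0))
  rw [add_zero] at ht
  exact ge_of_tendsto ht (Filter.eventually_of_mem self_mem_nhdsWithin hle)

end Chi

end SGM

/-! ### The soft maximum and its derivatives. -/

namespace SGM

section Soft

variable {ι : Type*} [Fintype ι]

/-- The partition function `∑ exp (β xᵢ)`. -/
noncomputable def softSum (β : ℝ) (x : ι → ℝ) : ℝ := ∑ i, Real.exp (β * x i)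

/-- The Gibbs weights `exp (β xᵢ) / ∑ exp (β xⱼ)`. -/
noncomputable def softWeight (β : ℝ) (x : ι → ℝ) (i : ι) : ℝ := Real.exp (β * x i) / softSum β x

/-- The function `(∑ exp (β xᵢ)) ^ (θ / β)`, a smooth approximation of `exp (θ max xᵢ)`. -/
noncomputable def softExpMax (θ β : ℝ) (x : ι → ℝ) : ℝ := Real.exp (θ / β * Real.log (softSum β x))

variable {θ β : ℝ} {x : ι → ℝ}

lemma softSum_pos [Nonempty ι] : 0 < softSum β x :=
  Finset.sum_pos (fun _ _ => Real.exp_pos _) Finset.univ_nonempty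

lemma softWeight_nonneg (i : ι) : 0 ≤ softWeight β x i :=
  div_nonneg (Real.exp_pos _).le (Finset.sum_nonneg fun _ _ => (Real.exp_pos _).le)

lemma sum_softWeight [Nonempty ι] : ∑ i, softWeight β x i = 1 := by
  simp only [softWeight]
  rw [← Finset.sum_div]
  exact div_self softSum_pos.ne'

lemma softWeight_le_one [Nonempty ι] (i : ι) : softWeight β x i ≤ 1 := by
  rw [← sum_softWeight (β := β) (x := x)]
  exact Finset.single_le_sum (fun j _ => softWeight_nonneg j) (Finset.mem_univ i)

lemma softExpMax_nonneg : 0 ≤ softExpMax θ β x := (Real.exp_pos _).le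

lemma exp_le_softExpMax (hθ : 0 ≤ θ) (hβ : 0 < β) (i : ι) :
    Real.exp (θ * x i) ≤ softExpMax θ β x := by
  have h : β * x i ≤ Real.log (softSum β x) := by
    rw [← Real.log_exp (β * x i)]
    exact Real.log_le_log (Real.exp_pos _) (Finset.single_le_sum
      (f := fun j => Real.exp (β * x j)) (fun j _ => (Real.exp_pos _).le) (Finset.mem_univ i))
  refine Real.exp_le_exp.2 ?_
  calc θ * x i = θ / β * (β * x i) := by field_simp
    _ ≤ _ := mul_le_mul_of_nonneg_left h (by positivity)

/-- Smoothing the maximum costs the factor `(card ι) ^ (θ / β)`, which tends to one as `β → ∞`. -/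
lemma softExpMax_le [Nonempty ι] (hθ : 0 ≤ θ) (hβ : 0 < β) {m : ℝ} (hx : ∀ i, x i ≤ m) :
    softExpMax θ β x ≤ Real.exp (θ / β * Real.log (Fintype.card ι)) * Real.exp (θ * m) := by
  have h : Real.log (softSum β x) ≤ Real.log (Fintype.card ι) + β * m := by
    rw [← Real.log_exp (β * m), ← Real.log_mul (by simp) (Real.exp_pos _).ne']
    refine Real.log_le_log softSum_pos ?_
    calc softSum β x ≤ ∑ _i : ι, Real.exp (β * m) := Finset.sum_le_sum fun i _ =>
          Real.exp_le_exp.2 (mul_le_mul_of_nonneg_left (hx i) hβ.le)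
      _ = _ := by rw [Finset.sum_const, Finset.card_univ, nsmul_eq_mul]
  rw [← Real.exp_add]
  refine Real.exp_le_exp.2 ?_
  calc _ ≤ θ / β * (Real.log (Fintype.card ι) + β * m) :=
        mul_le_mul_of_nonneg_left h (by positivity)
    _ = _ := by field_simp

section Deriv

variable {z : ι → ℝ → ℝ} {z' : ι → ℝ} {t : ℝ}

lemma hasDerivAt_softSum (hz : ∀ i, HasDerivAt (z i) (z' i) t) :
    HasDerivAt (fun s => softSum β fun i => z i s)
      (∑ i, Real.exp (β * z i t) * (β * z' i)) t :=
  HasDerivAt.fun_sum fun i _ => ((hz i).const_mul β).exp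

lemma hasDerivAt_softExpMax [Nonempty ι] (hβ : 0 < β) (hz : ∀ i, HasDerivAt (z i) (z' i) t) :
    HasDerivAt (fun s => softExpMax θ β fun i => z i s)
      (θ * (softExpMax θ β (fun i => z i t) * ∑ i, softWeight β (fun i => z i t) i * z' i)) t := by
  have h := (((hasDerivAt_softSum (β := β) hz).log softSum_pos.ne').const_mul (θ / β)).exp
  convert! h using 1
  have hS : softSum β (fun i => z i t) ≠ 0 := softSum_pos.ne'
  have : ∑ i, Real.exp (β * z i t) * (β * z' i) =
      β * softSum β (fun i => z i t) * ∑ i, softWeight β (fun i => z i t) i * z' i := by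
    rw [Finset.mul_sum]
    refine Finset.sum_congr rfl fun i _ => ?_
    rw [softWeight]
    field_simp
  rw [this, softExpMax]
  field_simp

lemma hasDerivAt_softWeight [Nonempty ι] (hz : ∀ i, HasDerivAt (z i) (z' i) t) (i : ι) :
    HasDerivAt (fun s => softWeight β (fun i => z i s) i)
      (β * softWeight β (fun i => z i t) i *
        (z' i - ∑ j, softWeight β (fun i => z i t) j * z' j)) t := by
  have hS : softSum β (fun i => z i t) ≠ 0 := softSum_pos.ne'
  have h := ((hz i).const_mul β).exp.div (hasDerivAt_softSum (β := β) hz) hS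
  convert! h using 1
  have : ∑ i, Real.exp (β * z i t) * (β * z' i) =
      β * softSum β (fun i => z i t) * ∑ i, softWeight β (fun i => z i t) i * z' i := by
    rw [Finset.mul_sum]
    refine Finset.sum_congr rfl fun i _ => ?_
    rw [softWeight]
    field_simp
  rw [this, softWeight]
  field_simp

end Deriv

lemma continuous_softExpMax [Nonempty ι] : Continuous (softExpMax θ β : (ι → ℝ) → ℝ) := by
  unfold softExpMax
  have : Continuous (softSum β : (ι → ℝ) → ℝ) := by unfold softSum; fun_prop
  exact Real.continuous_exp.comp (continuous_const.mul (this.log fun x => softSum_pos.ne'))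

lemma continuous_softWeight [Nonempty ι] (i : ι) :
    Continuous fun x : ι → ℝ => softWeight β x i := by
  unfold softWeight
  have : Continuous (softSum β : (ι → ℝ) → ℝ) := by unfold softSum; fun_prop
  exact Continuous.div (by fun_prop) this fun x => softSum_pos.ne'

end Soft

/-! ### Gaussian comparison along a rotation. -/

section Comparison

variable {ι κ : Type*} [Fintype κ]

/-- The linear images `xᵢ = ∑ₐ cᵢₐ gₐ`. -/
def lin (c : ι → κ → ℝ) (g : κ → ℝ) (i : ι) : ℝ := ∑ a, c i a * g a

lemma continuous_lin (c : ι → κ → ℝ) : Continuous (lin c) := by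
  unfold lin; fun_prop

lemma abs_lin_le {c : ι → κ → ℝ} {K : ℝ} (hK : ∀ i a, |c i a| ≤ K) (g : κ → ℝ) (i : ι) :
    |lin c g i| ≤ K * ∑ a, |g a| := by
  rw [Finset.mul_sum]
  refine (Finset.abs_sum_le_sum_abs _ _).trans (Finset.sum_le_sum fun a _ => ?_)
  rw [abs_mul]
  exact mul_le_mul_of_nonneg_right (hK i a) (abs_nonneg _)

lemma expBounded_lin (c : ι → κ → ℝ) (i : ι) : ExpBounded fun g => lin c g i := by
  exact ExpBounded.sum _ fun a _ => (ExpBounded.const (c i a)).mul (.coord a)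

lemma hasDerivAt_lin_line [DecidableEq κ] (c : ι → κ → ℝ) (g : κ → ℝ) (a : κ) (i : ι) :
    HasDerivAt (fun t : ℝ => lin c (g + t • Pi.single a 1) i) (c i a) 0 := by
  have h : HasDerivAt (fun t : ℝ => ∑ b, c i b * (g b + t * (Pi.single a (1 : ℝ) : κ → ℝ) b))
      (∑ b, c i b * (1 * (Pi.single a (1 : ℝ) : κ → ℝ) b)) 0 :=
    HasDerivAt.fun_sum fun b _ =>
      (((hasDerivAt_id (0 : ℝ)).mul_const _).const_add (g b)).const_mul (c i b)
  simpa [lin, Pi.single_apply] using h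

/-- The rotation `cos φ • A + sin φ • B`. -/
noncomputable def rot (A B : ι → κ → ℝ) (φ : ℝ) : ι → κ → ℝ :=
  fun i a => Real.cos φ * A i a + Real.sin φ * B i a

lemma hasDerivAt_lin_rot (A B : ι → κ → ℝ) (g : κ → ℝ) (i : ι) (φ : ℝ) :
    HasDerivAt (fun φ => lin (rot A B φ) g i) (lin (rot B (-A) φ) g i) φ := by
  unfold lin
  refine HasDerivAt.fun_sum fun a _ => HasDerivAt.mul_const ?_ _
  have := ((Real.hasDerivAt_cos φ).mul_const (A i a)).add
    ((Real.hasDerivAt_sin φ).mul_const (B i a))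
  convert! this using 1
  simp [rot]
  ring

variable [Fintype ι]

lemma exists_abs_le (c : ι → κ → ℝ) : ∃ K, 0 ≤ K ∧ ∀ i a, |c i a| ≤ K := by
  refine ⟨∑ i, ∑ a, |c i a|, Finset.sum_nonneg fun i _ => Finset.sum_nonneg fun a _ =>
    abs_nonneg _, fun i a => ?_⟩
  exact (Finset.single_le_sum (f := fun a => |c i a|) (fun _ _ => abs_nonneg _)
    (Finset.mem_univ a)).trans (Finset.single_le_sum (f := fun i => ∑ a, |c i a|)
    (fun _ _ => Finset.sum_nonneg fun _ _ => abs_nonneg _) (Finset.mem_univ i))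

lemma exists_abs_rot_le (A B : ι → κ → ℝ) : ∃ K, 0 ≤ K ∧ ∀ φ i a, |rot A B φ i a| ≤ K := by
  obtain ⟨K, hK0, hK⟩ := exists_abs_le A
  obtain ⟨K', hK0', hK'⟩ := exists_abs_le B
  refine ⟨K + K', by positivity, fun φ i a => (abs_add_le _ _).trans (add_le_add ?_ ?_)⟩
  · rw [abs_mul]
    exact (mul_le_of_le_one_left (abs_nonneg _) (Real.abs_cos_le_one φ)).trans (hK i a)
  · rw [abs_mul]
    exact (mul_le_of_le_one_left (abs_nonneg _) (Real.abs_sin_le_one φ)).trans (hK' i a)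

variable [Nonempty ι] {θ β : ℝ}

lemma expBounded_softWeight (c : ι → κ → ℝ) (i : ι) :
    ExpBounded fun g => softWeight β (lin c g) i :=
  .of_abs_le ((continuous_softWeight i).comp (continuous_lin c)) (.const 1) fun g => by
    rw [abs_of_nonneg (softWeight_nonneg i), abs_one]
    exact softWeight_le_one i

lemma expBounded_softExpMax (hθ : 0 ≤ θ) (hβ : 0 < β) (c : ι → κ → ℝ) :
    ExpBounded fun g => softExpMax θ β (lin c g) := by
  obtain ⟨K, hK0, hK⟩ := exists_abs_le c
  refine .of_le (continuous_softExpMax.comp (continuous_lin c))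
    (C := Real.exp (θ / β * Real.log (Fintype.card ι))) (c := θ * K) (Real.exp_pos _).le
    (by positivity) fun g => ?_
  rw [abs_of_nonneg softExpMax_nonneg, mul_assoc]
  exact softExpMax_le hθ hβ fun i => (le_abs_self _).trans (abs_lin_le hK g i)

/-- Each coordinate of `lin d g` is integrated by parts against the soft maximum times a Gibbs
weight. The derivative of the former contributes `θ`, that of the weight contributes `β` on the
diagonal and `-β` off it, hence the coefficients `β` and `β - θ` of the covariances. -/
lemma integral_softExpMax_mul_lin (hθ : 0 ≤ θ) (hβ : 0 < β) (c d : ι → κ → ℝ) :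
    ∫ g, softExpMax θ β (lin c g) * ∑ i, softWeight β (lin c g) i * lin d g i ∂stdGauss κ =
    ∫ g, softExpMax θ β (lin c g) * ∑ i, softWeight β (lin c g) i *
      (β * (∑ a, d i a * c i a) -
        (β - θ) * ∑ j, softWeight β (lin c g) j * ∑ a, d i a * c j a) ∂stdGauss κ := by
  classical
  have hF := expBounded_softExpMax (θ := θ) (β := β) hθ hβ c
  have hp := fun i => expBounded_softWeight (β := β) c i
  have hD : ∀ i a, ExpBounded fun g =>
      softExpMax θ β (lin c g) * (softWeight β (lin c g) i *
        (β * c i a + (θ - β) * ∑ j, softWeight β (lin c g) j * c j a)) := fun i a =>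
    hF.mul ((hp i).mul ((ExpBounded.const _).add ((ExpBounded.const _).mul
      (.sum _ fun j _ => (hp j).mul (.const _)))))
  have hI : ∀ i a, ∫ g, g a * (softExpMax θ β (lin c g) * softWeight β (lin c g) i) ∂stdGauss κ =
      ∫ g, softExpMax θ β (lin c g) * (softWeight β (lin c g) i *
        (β * c i a + (θ - β) * ∑ j, softWeight β (lin c g) j * c j a)) ∂stdGauss κ := by
    intro i a
    refine integral_coord_mul_stdGauss a (fun g => ?_) (hF.mul (hp i)).integrable
      (hD i a).integrable ((ExpBounded.coord a).mul (hF.mul (hp i))).integrable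
    have hz := fun j => hasDerivAt_lin_line c g a j
    have h := (hasDerivAt_softExpMax (θ := θ) hβ hz).mul (hasDerivAt_softWeight (β := β) hz i)
    unfold HasLineDerivAt
    convert! h using 1
    simp only [zero_smul, add_zero]
    ring
  have h1 : ∀ g, softExpMax θ β (lin c g) * ∑ i, softWeight β (lin c g) i * lin d g i =
      ∑ i, ∑ a, d i a * (g a * (softExpMax θ β (lin c g) * softWeight β (lin c g) i)) := fun g => by
    rw [Finset.mul_sum]
    refine Finset.sum_congr rfl fun i _ => ?_
    rw [lin, Finset.mul_sum, Finset.mul_sum]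
    exact Finset.sum_congr rfl fun a _ => by ring
  have h2 : ∀ g, softExpMax θ β (lin c g) * ∑ i, softWeight β (lin c g) i *
      (β * (∑ a, d i a * c i a) -
        (β - θ) * ∑ j, softWeight β (lin c g) j * ∑ a, d i a * c j a) =
      ∑ i, ∑ a, d i a * (softExpMax θ β (lin c g) * (softWeight β (lin c g) i *
        (β * c i a + (θ - β) * ∑ j, softWeight β (lin c g) j * c j a))) := fun g => by
    rw [Finset.mul_sum]
    refine Finset.sum_congr rfl fun i _ => ?_
    have h3 : ∑ j, softWeight β (lin c g) j * ∑ a, d i a * c j a =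
        ∑ a, d i a * ∑ j, softWeight β (lin c g) j * c j a := by
      simp only [Finset.mul_sum]
      rw [Finset.sum_comm]
      exact Finset.sum_congr rfl fun a _ => Finset.sum_congr rfl fun j _ => by ring
    rw [h3, Finset.mul_sum, Finset.mul_sum, ← Finset.sum_sub_distrib, Finset.mul_sum,
      Finset.mul_sum]
    exact Finset.sum_congr rfl fun a _ => by ring
  simp only [h1, h2]
  rw [integral_finsetSum _ fun i _ => (ExpBounded.sum _ fun a _ => (ExpBounded.const (d i a)).mul
      ((ExpBounded.coord a).mul (hF.mul (hp i)))).integrable,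
    integral_finsetSum _ fun i _ => (ExpBounded.sum _ fun a _ => (ExpBounded.const (d i a)).mul
      (hD i a)).integrable]
  refine Finset.sum_congr rfl fun i _ => ?_
  rw [integral_finsetSum _ fun a _ => ((ExpBounded.const (d i a)).mul
      ((ExpBounded.coord a).mul (hF.mul (hp i)))).integrable,
    integral_finsetSum _ fun a _ => ((ExpBounded.const (d i a)).mul (hD i a)).integrable]
  refine Finset.sum_congr rfl fun a _ => ?_
  rw [integral_const_mul, integral_const_mul, hI]

/-- Differentiation under the integral: the rotated coefficients are bounded uniformly in the angle,
so one function of exponential growth dominates all derivatives. -/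
lemma hasDerivAt_integral_softExpMax_rot (hθ : 0 ≤ θ) (hβ : 0 < β) (A B : ι → κ → ℝ) (φ : ℝ) :
    HasDerivAt (fun φ => ∫ g, softExpMax θ β (lin (rot A B φ) g) ∂stdGauss κ)
      (∫ g, θ * (softExpMax θ β (lin (rot A B φ) g) *
        ∑ i, softWeight β (lin (rot A B φ) g) i * lin (rot B (-A) φ) g i) ∂stdGauss κ) φ := by
  obtain ⟨K, hK0, hK⟩ := exists_abs_rot_le A B
  obtain ⟨K', hK0', hK'⟩ := exists_abs_rot_le B (-A)
  set N := Real.exp (θ / β * Real.log (Fintype.card ι)) with hN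
  have hF := fun c : ι → κ → ℝ => expBounded_softExpMax (θ := θ) (β := β) hθ hβ c
  have hp := fun (c : ι → κ → ℝ) i => expBounded_softWeight (β := β) c i
  refine (hasDerivAt_integral_of_dominated_loc_of_deriv_le (s := Set.univ) Filter.univ_mem
    (F := fun φ g => softExpMax θ β (lin (rot A B φ) g))
    (F' := fun φ g => θ * (softExpMax θ β (lin (rot A B φ) g) *
        ∑ i, softWeight β (lin (rot A B φ) g) i * lin (rot B (-A) φ) g i))
    (bound := fun g : κ → ℝ => θ * ((N * Real.exp (θ * K * ∑ a, |g a|)) *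
      ((Fintype.card ι : ℝ) * (K' * ∑ a, |g a|))))
    (Filter.Eventually.of_forall fun φ => (hF _).integrable.aestronglyMeasurable)
    (hF _).integrable ?_ ?_ ?_ ?_).2
  · exact ((ExpBounded.const θ).mul ((hF _).mul (ExpBounded.sum _ fun i _ =>
      (hp _ i).mul (expBounded_lin _ i)))).integrable.aestronglyMeasurable
  · refine Filter.Eventually.of_forall fun g ψ _ => ?_
    rw [Real.norm_eq_abs, abs_mul, abs_of_nonneg hθ, abs_mul,
      abs_of_nonneg softExpMax_nonneg]
    refine mul_le_mul_of_nonneg_left (mul_le_mul ?_ ?_ (abs_nonneg _) (by positivity)) hθ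
    · rw [mul_assoc θ]
      exact softExpMax_le hθ hβ fun i => (le_abs_self _).trans (abs_lin_le (hK ψ) g i)
    · refine (Finset.abs_sum_le_sum_abs _ _).trans ?_
      rw [← Finset.card_univ, ← nsmul_eq_mul]
      refine Finset.sum_le_card_nsmul _ _ _ fun i _ => ?_
      rw [abs_mul, abs_of_nonneg (softWeight_nonneg i)]
      exact (mul_le_of_le_one_left (abs_nonneg _) (softWeight_le_one i)).trans
        (abs_lin_le (hK' ψ) g i)
  · exact ((ExpBounded.const θ).mul (((ExpBounded.const N).mul
      (.exp_sum_abs (by positivity))).mul ((ExpBounded.const _).mul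
      ((ExpBounded.const K').mul .sum_abs)))).integrable
  · exact Filter.Eventually.of_forall fun g ψ _ =>
      hasDerivAt_softExpMax hβ fun i => hasDerivAt_lin_rot A B g i ψ

/-- A Gaussian comparison inequality of Slepian type for exponential moments. -/
lemma integral_softExpMax_comparison (hθ : 0 ≤ θ) (hβ : 0 < β) (hθβ : θ ≤ β) (A B : ι → κ → ℝ)
    (hAB : ∀ i j, ∑ a, A i a * B j a = 0)
    (hle : ∀ i j, ∑ a, B i a * B j a - ∑ a, A i a * A j a ≤ 1)
    (hdiag : ∀ i, ∑ a, B i a * B i a - ∑ a, A i a * A i a = 1) :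
    Real.exp (θ ^ 2 / 2) * ∫ g, softExpMax θ β (lin A g) ∂stdGauss κ ≤
      ∫ g, softExpMax θ β (lin B g) ∂stdGauss κ := by
  set F : ℝ → ℝ := fun φ => ∫ g, softExpMax θ β (lin (rot A B φ) g) ∂stdGauss κ with hFdef
  set F' : ℝ → ℝ := fun φ => ∫ g, θ * (softExpMax θ β (lin (rot A B φ) g) *
        ∑ i, softWeight β (lin (rot A B φ) g) i * lin (rot B (-A) φ) g i) ∂stdGauss κ with hF'def
  have hF := fun c : ι → κ → ℝ => expBounded_softExpMax (θ := θ) (β := β) hθ hβ c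
  have hp := fun (c : ι → κ → ℝ) i => expBounded_softWeight (β := β) c i
  have hd : ∀ φ, HasDerivAt F (F' φ) φ := hasDerivAt_integral_softExpMax_rot hθ hβ A B
  -- Covariance between the velocity of the rotation and its position; the cross terms vanish
  -- because `A` and `B` are uncorrelated.
  have hr : ∀ φ i j, ∑ a, rot B (-A) φ i a * rot A B φ j a = Real.sin φ * Real.cos φ *
      (∑ a, B i a * B j a - ∑ a, A i a * A j a) := by
    intro φ i j
    have h : ∑ a, rot B (-A) φ i a * rot A B φ j a =
        Real.cos φ ^ 2 * ∑ a, A j a * B i a + Real.sin φ * Real.cos φ * ∑ a, B i a * B j a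
        - Real.sin φ * Real.cos φ * ∑ a, A i a * A j a
        - Real.sin φ ^ 2 * ∑ a, A i a * B j a := by
      simp only [Finset.mul_sum]
      rw [← Finset.sum_add_distrib, ← Finset.sum_sub_distrib, ← Finset.sum_sub_distrib]
      refine Finset.sum_congr rfl fun a _ => ?_
      simp only [rot, Pi.neg_apply]
      ring
    rw [h, hAB, hAB]
    ring
  have hF' : ∀ φ, 0 ≤ Real.sin φ * Real.cos φ →
      θ ^ 2 * (Real.sin φ * Real.cos φ) * F φ ≤ F' φ := by
    intro φ hφ
    simp only [hFdef, hF'def]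
    rw [integral_const_mul, integral_softExpMax_mul_lin hθ hβ, ← integral_const_mul,
      ← integral_const_mul]
    refine integral_mono ((ExpBounded.const _).mul (hF _)).integrable
      ((ExpBounded.const θ).mul ((hF _).mul (ExpBounded.sum _ fun i _ => (hp _ i).mul ?_))).integrable
      fun g => ?_
    · simp only [sub_eq_add_neg, ← neg_mul]
      exact (ExpBounded.const _).add ((ExpBounded.const _).mul
        (ExpBounded.sum _ fun j _ => (hp _ j).mul (.const _)))
    · simp only
      set p := softWeight β (lin (rot A B φ) g) with hpdef
      have hp0 : ∀ i, 0 ≤ p i := fun i => softWeight_nonneg i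
      have hp1 : ∑ i, p i = 1 := sum_softWeight
      -- The diagonal is known exactly and gives `β`. The averaged term is only bounded above, and
      -- enters with the sign `-(β - θ) ≤ 0`; the difference leaves `θ`.
      have hin : ∀ i, θ * (Real.sin φ * Real.cos φ) ≤ β * (∑ a, rot B (-A) φ i a * rot A B φ i a) -
          (β - θ) * ∑ j, p j * ∑ a, rot B (-A) φ i a * rot A B φ j a := by
        intro i
        have h1 : ∑ j, p j * ∑ a, rot B (-A) φ i a * rot A B φ j a ≤ Real.sin φ * Real.cos φ := by
          calc _ ≤ ∑ j, p j * (Real.sin φ * Real.cos φ) := by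
                refine Finset.sum_le_sum fun j _ => mul_le_mul_of_nonneg_left ?_ (hp0 j)
                rw [hr]
                exact mul_le_of_le_one_right hφ (hle i j)
            _ = _ := by rw [← Finset.sum_mul, hp1, one_mul]
        rw [hr φ i i, hdiag, mul_one]
        have := mul_le_mul_of_nonneg_left h1 (sub_nonneg.2 hθβ)
        linarith
      have hsum : θ * (Real.sin φ * Real.cos φ) ≤ ∑ i, p i *
          (β * (∑ a, rot B (-A) φ i a * rot A B φ i a) -
          (β - θ) * ∑ j, p j * ∑ a, rot B (-A) φ i a * rot A B φ j a) := by
        calc _ = ∑ i, p i * (θ * (Real.sin φ * Real.cos φ)) := by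
              rw [← Finset.sum_mul, hp1, one_mul]
          _ ≤ _ := Finset.sum_le_sum fun i _ => mul_le_mul_of_nonneg_left (hin i) (hp0 i)
      have hE : 0 ≤ softExpMax θ β (lin (rot A B φ) g) := softExpMax_nonneg
      have := mul_le_mul_of_nonneg_left (mul_le_mul_of_nonneg_left hsum hE) hθ
      linarith
  -- The integrating factor for `F' ≥ θ ^ 2 * sin φ * cos φ * F`; between `0` and `π / 2` it changes
  -- from `1` to `exp (-(θ ^ 2 / 2))`.
  set G : ℝ → ℝ := fun φ => Real.exp (-(θ ^ 2 / 2 * Real.sin φ ^ 2)) * F φ with hG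
  have hGd : ∀ φ, HasDerivAt G (Real.exp (-(θ ^ 2 / 2 * Real.sin φ ^ 2)) *
      (F' φ - θ ^ 2 * (Real.sin φ * Real.cos φ) * F φ)) φ := by
    intro φ
    have h := ((((Real.hasDerivAt_sin φ).fun_pow 2).const_mul (θ ^ 2 / 2)).fun_neg.exp).mul (hd φ)
    convert! h using 1
    simp
    ring
  have hmono : MonotoneOn G (Set.Icc 0 (Real.pi / 2)) := by
    refine monotoneOn_of_deriv_nonneg (convex_Icc _ _)
      (fun φ _ => (hGd φ).continuousAt.continuousWithinAt)
      (fun φ _ => (hGd φ).differentiableAt.differentiableWithinAt) fun φ hφ => ?_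
    rw [interior_Icc] at hφ
    rw [(hGd φ).deriv]
    refine mul_nonneg (Real.exp_pos _).le (sub_nonneg.2 (hF' φ (mul_nonneg ?_ ?_)))
    · exact Real.sin_nonneg_of_nonneg_of_le_pi hφ.1.le (by linarith [hφ.2, Real.pi_pos])
    · exact Real.cos_nonneg_of_neg_pi_div_two_le_of_le (by linarith [hφ.1, Real.pi_pos]) hφ.2.le
  have hpi : (0 : ℝ) ≤ Real.pi / 2 := by positivity
  have h := hmono (Set.left_mem_Icc.2 hpi) (Set.right_mem_Icc.2 hpi) hpi
  have e0 : rot A B 0 = A := by ext; simp [rot]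
  have e1 : rot A B (Real.pi / 2) = B := by ext; simp [rot]
  simp only [hG, hFdef, e0, e1, Real.sin_zero, Real.sin_pi_div_two] at h
  simp only [ne_eq, OfNat.ofNat_ne_zero, not_false_eq_true, zero_pow, mul_zero, neg_zero,
    Real.exp_zero, one_mul, one_pow, mul_one] at h
  have h2 := mul_le_mul_of_nonneg_left h (Real.exp_pos (θ ^ 2 / 2)).le
  rwa [← mul_assoc, ← Real.exp_add, add_neg_cancel, Real.exp_zero, one_mul] at h2

end Comparison

end SGM

/-! ### Tail of the operator norm of a Gaussian matrix. -/

namespace SGM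

section Product

variable {α δ : Type*} [Fintype α] [Fintype δ]

lemma measurePreserving_stdGauss_sum :
    MeasurePreserving (fun g : α ⊕ δ → ℝ => (fun a => g (.inl a), fun b => g (.inr b)))
      (stdGauss (α ⊕ δ)) ((stdGauss α).prod (stdGauss δ)) :=
  measurePreserving_sumPiEquivProdPi (X := fun _ : α ⊕ δ => ℝ) fun _ => gaussianReal 0 1

lemma integral_stdGauss_comp_inl {F : (α → ℝ) → ℝ} (hF : Continuous F) :
    ∫ g : α ⊕ δ → ℝ, F (fun a => g (.inl a)) ∂stdGauss (α ⊕ δ) = ∫ g, F g ∂stdGauss α := by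
  have hmp := measurePreserving_fst.comp (measurePreserving_stdGauss_sum (α := α) (δ := δ))
  rw [← hmp.map_eq, integral_map hmp.measurable.aemeasurable hF.aestronglyMeasurable]
  rfl

lemma integral_stdGauss_comp_inr {F : (δ → ℝ) → ℝ} (hF : Continuous F) :
    ∫ g : α ⊕ δ → ℝ, F (fun b => g (.inr b)) ∂stdGauss (α ⊕ δ) = ∫ g, F g ∂stdGauss δ := by
  have hmp := measurePreserving_snd.comp (measurePreserving_stdGauss_sum (α := α) (δ := δ))
  rw [← hmp.map_eq, integral_map hmp.measurable.aemeasurable hF.aestronglyMeasurable]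
  rfl

/-- The two blocks are independent, so the moments multiply and the two terms `θ ^ 2 / 2` add up to
`θ ^ 2`. -/
lemma integral_exp_sqrt_add_sqrt_le {θ : ℝ} (hθ : 0 ≤ θ) :
    ∫ g : α ⊕ δ → ℝ, Real.exp (θ * (√(∑ a, g (.inl a) ^ 2) + √(∑ b, g (.inr b) ^ 2)))
      ∂stdGauss (α ⊕ δ) ≤
    Real.exp (θ * (√(Fintype.card α) + √(Fintype.card δ)) + θ ^ 2) := by
  have h1 : ∫ g : α ⊕ δ → ℝ, Real.exp (θ * (√(∑ a, g (.inl a) ^ 2) + √(∑ b, g (.inr b) ^ 2)))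
      ∂stdGauss (α ⊕ δ) = ∫ p : (α → ℝ) × (δ → ℝ), Real.exp (θ * √(∑ a, p.1 a ^ 2)) *
        Real.exp (θ * √(∑ b, p.2 b ^ 2)) ∂(stdGauss α).prod (stdGauss δ) := by
    rw [← measurePreserving_stdGauss_sum.map_eq, integral_map
      measurePreserving_stdGauss_sum.measurable.aemeasurable]
    · simp only [← Real.exp_add, mul_add]
    · exact Continuous.aestronglyMeasurable (by fun_prop)
  rw [h1, integral_prod_mul (μ := stdGauss α) (ν := stdGauss δ)
    (fun g => Real.exp (θ * √(∑ a, g a ^ 2))) fun g => Real.exp (θ * √(∑ b, g b ^ 2))]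
  refine (mul_le_mul (integral_exp_sqrt_sum_sq_le hθ) (integral_exp_sqrt_sum_sq_le hθ)
    (integral_nonneg fun _ => (Real.exp_pos _).le) (Real.exp_pos _).le).trans_eq ?_
  rw [← Real.exp_add]
  congr 1
  ring

end Product

section OpNorm

variable {α δ : Type*} [Fintype α] [Fintype δ]

lemma sum_mul_le_one_of_sum_sq_eq_one {u v : α → ℝ} (hu : ∑ a, u a ^ 2 = 1)
    (hv : ∑ a, v a ^ 2 = 1) : ∑ a, u a * v a ≤ 1 := by
  have := Real.sum_mul_le_sqrt_mul_sqrt Finset.univ u v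
  rwa [hu, hv, Real.sqrt_one, one_mul] at this

lemma sqrt_sum_sq_comp_le (g : δ → ℝ) {f : α → δ} (hf : Function.Injective f) :
    √(∑ a, g (f a) ^ 2) ≤ ∑ q, |g q| := by
  classical
  have h0 : ∑ a, |g (f a)| ≤ ∑ q, |g q| := by
    rw [← Finset.sum_image (f := fun q => |g q|) (s := Finset.univ) hf.injOn]
    exact Finset.sum_le_univ_sum_of_nonneg fun _ => abs_nonneg _
  refine (Real.sqrt_le_sqrt (sum_sq_le_sum_abs_sq _)).trans ?_
  rwa [Real.sqrt_sq (Finset.sum_nonneg fun _ _ => abs_nonneg _)]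

/-- The bilinear process is compared with `⟨g, u⟩ + ⟨h, v⟩`, which is at most `|g| + |h|` by
Cauchy–Schwarz. Half of the `θ ^ 2` in the moment of `|g| + |h|` is recovered by the gain in the
comparison. -/
lemma integral_softExpMax_bilin_le {ι : Type*} [Fintype ι] [Nonempty ι] {θ β : ℝ} (hθ : 0 ≤ θ)
    (hβ : 0 < β) (hθβ : θ ≤ β) (u : ι → α → ℝ) (v : ι → δ → ℝ) (hu : ∀ i, ∑ a, u i a ^ 2 = 1)
    (hv : ∀ i, ∑ b, v i b ^ 2 = 1) :
    ∫ g : α × δ → ℝ, softExpMax θ β (lin (fun i q => u i q.1 * v i q.2) g) ∂stdGauss (α × δ) ≤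
      Real.exp (θ / β * Real.log (Fintype.card ι)) *
        Real.exp (θ * (√(Fintype.card α) + √(Fintype.card δ)) + θ ^ 2 / 2) := by
  -- Both processes live on one Gaussian space and use disjoint coordinates, hence are uncorrelated.
  set A : ι → (α × δ) ⊕ (α ⊕ δ) → ℝ :=
    fun i => Sum.elim (fun q => u i q.1 * v i q.2) fun _ => 0 with hA
  set B : ι → (α × δ) ⊕ (α ⊕ δ) → ℝ :=
    fun i => Sum.elim (fun _ => 0) (Sum.elim (u i) (v i)) with hB
  have hAA : ∀ i j, ∑ q, A i q * A j q = (∑ a, u i a * u j a) * ∑ b, v i b * v j b := by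
    intro i j
    simp only [hA, Fintype.sum_sum_type, Sum.elim_inl, Sum.elim_inr, mul_zero,
      Finset.sum_const_zero, add_zero]
    rw [Finset.sum_mul_sum, Fintype.sum_prod_type]
    exact Finset.sum_congr rfl fun a _ => Finset.sum_congr rfl fun b _ => by ring
  have hBB : ∀ i j, ∑ q, B i q * B j q = (∑ a, u i a * u j a) + ∑ b, v i b * v j b := by
    intro i j
    simp [hB, Fintype.sum_sum_type]
  have key := integral_softExpMax_comparison hθ hβ hθβ A B
    (fun i j => by simp [hA, hB, Fintype.sum_sum_type])
    (fun i j => by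
      rw [hAA, hBB]
      -- With `a`, `b` the inner products of the unit vectors, `a + b - a * b = 1 - (1 - a) * (1 -
      -- b) ≤ 1`.
      nlinarith [mul_nonneg (sub_nonneg.2 (sum_mul_le_one_of_sum_sq_eq_one (hu i) (hu j))) (sub_nonneg.2 (sum_mul_le_one_of_sum_sq_eq_one (hv i) (hv j)))])
    (fun i => by
      have h1 := hu i
      have h2 := hv i
      simp only [sq] at h1 h2
      rw [hAA, hBB, h1, h2]
      norm_num)
  have hX : ∫ g, softExpMax θ β (lin A g) ∂stdGauss ((α × δ) ⊕ (α ⊕ δ)) =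
      ∫ g, softExpMax θ β (lin (fun i q => u i q.1 * v i q.2) g) ∂stdGauss (α × δ) := by
    have hF : Continuous fun g : α × δ → ℝ =>
        softExpMax θ β (lin (fun i q => u i q.1 * v i q.2) g) :=
      continuous_softExpMax.comp (continuous_lin fun i (q : α × δ) => u i q.1 * v i q.2)
    rw [← integral_stdGauss_comp_inl (δ := α ⊕ δ) hF]
    congr 1 with g
    congr 1
    ext i
    simp [lin, hA, Fintype.sum_sum_type]
  have hY : ∫ g, softExpMax θ β (lin B g) ∂stdGauss ((α × δ) ⊕ (α ⊕ δ)) ≤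
      Real.exp (θ / β * Real.log (Fintype.card ι)) *
        Real.exp (θ * (√(Fintype.card α) + √(Fintype.card δ)) + θ ^ 2) := by
    have hmap : ∫ g : (α × δ) ⊕ (α ⊕ δ) → ℝ, Real.exp (θ * (√(∑ a, g (.inr (.inl a)) ^ 2)
          + √(∑ b, g (.inr (.inr b)) ^ 2))) ∂stdGauss ((α × δ) ⊕ (α ⊕ δ)) =
        ∫ g : α ⊕ δ → ℝ, Real.exp (θ * (√(∑ a, g (.inl a) ^ 2) + √(∑ b, g (.inr b) ^ 2)))
          ∂stdGauss (α ⊕ δ) := by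
      have hF : Continuous fun g : α ⊕ δ → ℝ =>
          Real.exp (θ * (√(∑ a, g (.inl a) ^ 2) + √(∑ b, g (.inr b) ^ 2))) := by fun_prop
      rw [← integral_stdGauss_comp_inr (α := α × δ) hF]
    refine le_trans ?_ (mul_le_mul_of_nonneg_left (integral_exp_sqrt_add_sqrt_le hθ)
      (Real.exp_pos _).le)
    rw [← hmap, ← integral_const_mul]
    refine integral_mono (expBounded_softExpMax hθ hβ B).integrable ?_ fun g => ?_
    · refine Integrable.const_mul (ExpBounded.integrable (.of_le (C := 1) (c := θ * 2) (by fun_prop)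
        zero_le_one (by positivity) fun g => ?_)) _
      rw [Real.abs_exp, one_mul, Real.exp_le_exp, mul_assoc, two_mul]
      exact mul_le_mul_of_nonneg_left (add_le_add
        (sqrt_sum_sq_comp_le g (Sum.inr_injective.comp Sum.inl_injective))
        (sqrt_sum_sq_comp_le g (Sum.inr_injective.comp Sum.inr_injective))) hθ
    · refine softExpMax_le hθ hβ fun i => ?_
      have h1 := Real.sum_mul_le_sqrt_mul_sqrt Finset.univ (u i) fun a => g (.inr (.inl a))
      have h2 := Real.sum_mul_le_sqrt_mul_sqrt Finset.univ (v i) fun a => g (.inr (.inr a))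
      rw [hu, Real.sqrt_one, one_mul] at h1
      rw [hv, Real.sqrt_one, one_mul] at h2
      simpa [lin, hB, Fintype.sum_sum_type] using add_le_add h1 h2
  rw [hX] at key
  have h2 := mul_le_mul_of_nonneg_left (key.trans hY) (Real.exp_pos (-(θ ^ 2 / 2))).le
  rw [← mul_assoc, ← Real.exp_add, neg_add_cancel, Real.exp_zero, one_mul] at h2
  refine h2.trans_eq ?_
  rw [mul_left_comm, ← Real.exp_add]
  congr 2
  ring

/-- Markov's inequality with the optimal exponent `θ = s`, followed by `β → ∞` to remove the cost of
smoothing. -/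
lemma stdGauss_finite_bilin_gt_le {ι : Type*} [Fintype ι] [Nonempty ι] {s : ℝ} (hs : 0 < s)
    (u : ι → α → ℝ) (v : ι → δ → ℝ) (hu : ∀ i, ∑ a, u i a ^ 2 = 1)
    (hv : ∀ i, ∑ b, v i b ^ 2 = 1) :
    (stdGauss (α × δ)).real {g | ∃ i, √(Fintype.card α) + √(Fintype.card δ) + s <
      lin (fun i q => u i q.1 * v i q.2) g i} ≤ Real.exp (-s ^ 2 / 2) := by
  set τ := √(Fintype.card α) + √(Fintype.card δ) + s with hτ
  set c : ι → α × δ → ℝ := fun i q => u i q.1 * v i q.2 with hc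
  have h1 : ∀ β, s ≤ β → (stdGauss (α × δ)).real {g | ∃ i, τ <
      lin c g i} ≤
      Real.exp (s / β * Real.log (Fintype.card ι)) * Real.exp (-s ^ 2 / 2) := by
    intro β hβs
    have hβ : 0 < β := hs.trans_le hβs
    have hm := mul_meas_ge_le_integral_of_nonneg (μ := stdGauss (α × δ))
      (f := fun g => softExpMax s β (lin c g))
      (Filter.Eventually.of_forall fun g => softExpMax_nonneg (x := lin c g))
      (expBounded_softExpMax hs.le hβ c).integrable (Real.exp (s * τ))
    have hsub : (stdGauss (α × δ)).real {g | ∃ i, τ < lin c g i} ≤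
        (stdGauss (α × δ)).real {g | Real.exp (s * τ) ≤
          softExpMax s β (lin c g)} := by
      refine measureReal_mono fun g hg => ?_
      obtain ⟨i, hi⟩ := hg
      exact (Real.exp_le_exp.2 (mul_le_mul_of_nonneg_left hi.le hs.le)).trans
        (exp_le_softExpMax hs.le hβ i)
    have h2 := (mul_le_mul_of_nonneg_left hsub (Real.exp_pos (s * τ)).le).trans
      (hm.trans (integral_softExpMax_bilin_le hs.le hβ hβs u v hu hv))
    rw [← le_div_iff₀' (Real.exp_pos _)] at h2
    refine h2.trans_eq ?_
    rw [mul_div_assoc, ← Real.exp_sub]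
    congr 2
    rw [hτ]
    ring
  have ht : Filter.Tendsto (fun β : ℝ => Real.exp (s / β * Real.log (Fintype.card ι)) *
      Real.exp (-s ^ 2 / 2)) Filter.atTop (nhds (Real.exp (-s ^ 2 / 2))) := by
    have h0 : Filter.Tendsto (fun β : ℝ => s / β * Real.log (Fintype.card ι)) Filter.atTop
        (nhds (0 * Real.log (Fintype.card ι))) :=
      (Filter.tendsto_id.const_div_atTop s).mul_const _
    rw [zero_mul] at h0
    have := ((Real.continuous_exp.tendsto 0).comp h0).mul_const (Real.exp (-s ^ 2 / 2))
    simpa using this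
  exact ge_of_tendsto ht (Filter.eventually_atTop.2 ⟨s, h1⟩)

/-- The finite bound does not depend on the number of vectors, so it survives an increasing union.
-/
lemma stdGauss_bilin_gt_le {s : ℝ} (hs : 0 < s) (u : ℕ → α → ℝ) (v : ℕ → δ → ℝ)
    (hu : ∀ i, ∑ a, u i a ^ 2 = 1) (hv : ∀ i, ∑ b, v i b ^ 2 = 1) :
    stdGauss (α × δ) {g | ∃ i, √(Fintype.card α) + √(Fintype.card δ) + s <
      lin (fun i q => u i q.1 * v i q.2) g i} ≤ ENNReal.ofReal (Real.exp (-s ^ 2 / 2)) := by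
  set τ := √(Fintype.card α) + √(Fintype.card δ) + s with hτ
  set S : ℕ → Set (α × δ → ℝ) := fun N => {g | ∃ i : Fin (N + 1), τ <
    lin (fun (i : Fin (N + 1)) q => u i q.1 * v i q.2) g i} with hS
  have hU : {g | ∃ i, τ < lin (fun i q => u i q.1 * v i q.2) g i} = ⋃ N, S N := by
    ext g
    simp only [Set.mem_iUnion, Set.mem_ofPred_eq, hS]
    exact ⟨fun ⟨i, hi⟩ => ⟨i, ⟨i, Nat.lt_succ_self i⟩, hi⟩, fun ⟨_, i, hi⟩ => ⟨i, hi⟩⟩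
  have hmono : Monotone S := fun N N' h g ⟨i, hi⟩ => ⟨⟨i, by omega⟩, hi⟩
  rw [hU, hmono.measure_iUnion]
  refine iSup_le fun N => ?_
  rw [ENNReal.le_ofReal_iff_toReal_le (measure_ne_top _ _) (Real.exp_pos _).le]
  exact stdGauss_finite_bilin_gt_le hs _ _ (fun i => hu i) fun i => hv i

end OpNorm

section MatrixNorm

open scoped Matrix.Norms.L2Operator

/-- For a unit vector `x` with `V x ≠ 0`, testing with `u = V x / ‖V x‖` gives exactly `‖V x‖`. -/
lemma l2_opNorm_le_of_forall_bilin {n m : ℕ} {V : Matrix (Fin n) (Fin m) ℝ} {K : ℝ} (hK : 0 ≤ K)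
    (h : ∀ (u : Fin n → ℝ) (v : Fin m → ℝ), ∑ a, u a ^ 2 = 1 → ∑ b, v b ^ 2 = 1 → ∑ a, ∑ b, u a * v b * V a b ≤ K) :
    ‖V‖ ≤ K := by
  rw [Matrix.l2_opNorm_def]
  refine ContinuousLinearMap.opNorm_le_of_unit_norm hK fun x hx => ?_
  change ‖WithLp.toLp 2 (V *ᵥ x.ofLp)‖ ≤ K
  set y := WithLp.toLp 2 (V *ᵥ x.ofLp) with hy
  by_cases h0 : ‖y‖ = 0
  · rwa [h0]
  have hsq : ∑ a, y a ^ 2 = ‖y‖ ^ 2 := (EuclideanSpace.real_norm_sq_eq y).symm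
  have := h (fun a => y a / ‖y‖) x.ofLp
    (by simp only [div_pow]; rw [← Finset.sum_div, hsq, div_self (pow_ne_zero 2 h0)])
    (by rw [← EuclideanSpace.real_norm_sq_eq x, hx, one_pow])
  have e : ∑ a, ∑ b, y a / ‖y‖ * x.ofLp b * V a b = ‖y‖ := by
    have : ∀ a, ∑ b, y a / ‖y‖ * x.ofLp b * V a b = y a ^ 2 / ‖y‖ := fun a => by
      have hya : y a = ∑ b, V a b * x.ofLp b := rfl
      calc _ = y a / ‖y‖ * ∑ b, V a b * x.ofLp b := by
            rw [Finset.mul_sum]; exact Finset.sum_congr rfl fun b _ => by ring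
        _ = _ := by rw [← hya]; ring
    simp only [this]
    rw [← Finset.sum_div, hsq, sq, mul_div_cancel_right₀ _ h0]
  rwa [e] at this

/-- The operator norm of a matrix with independent centered Gaussian entries of equal variance. -/
lemma measure_l2_opNorm_gt_le {Ω : Type*} [MeasurableSpace Ω] {P : Measure Ω}
    [IsProbabilityMeasure P] {n m : ℕ} (hn : 1 ≤ n) (hm : 1 ≤ m) {c : ℝ≥0} (hc : c ≠ 0)
    {V : Ω → Matrix (Fin n) (Fin m) ℝ}
    (hV : IndepCenteredGaussians P (fun _ : Fin n × Fin m => c) fun q ω => V ω q.1 q.2)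
    {s : ℝ} (hs : 0 < s) :
    P {ω | √c * (√n + √m + s) < ‖V ω‖} ≤ ENNReal.ofReal (Real.exp (-s ^ 2 / 2)) := by
  have hc0 : 0 < √(c : ℝ) := Real.sqrt_pos.2 (by positivity)
  set G : Ω → Fin n × Fin m → ℝ := fun ω (q : Fin n × Fin m) => (√c)⁻¹ * V ω q.1 q.2 with hG
  have hGm : Measurable G := measurable_pi_lambda _ fun q => (hV.measurable q).const_mul _
  have hlaw : P.map G = stdGauss (Fin n × Fin m) := by
    have hind : iIndepFun (fun (q : Fin n × Fin m) ω => (√c)⁻¹ * V ω q.1 q.2) P :=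
      hV.indep.comp (fun _ x => (√c)⁻¹ * x) fun _ => by fun_prop
    have := (iIndepFun_iff_map_fun_eq_pi_map
      (fun q => ((hV.measurable q).const_mul _).aemeasurable)).1 hind
    rw [hG, this, stdGauss]
    congr 1
    ext1 q
    have h1 : P.map (fun ω => (√c)⁻¹ * V ω q.1 q.2) =
        (P.map fun ω => V ω q.1 q.2).map fun x => (√c)⁻¹ * x := by
      rw [Measure.map_map (by fun_prop) (hV.measurable q)]
      rfl
    rw [h1, hV.law q, gaussianReal_map_const_mul, mul_zero]
    congr 1
    ext
    simp [inv_pow, inv_mul_cancel₀ (NNReal.coe_ne_zero.2 hc)]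
  have : Nonempty (Fin n) := ⟨⟨0, hn⟩⟩
  have : Nonempty (Fin m) := ⟨⟨0, hm⟩⟩
  have : Nonempty (Metric.sphere (0 : EuclideanSpace ℝ (Fin n)) 1) :=
    (NormedSpace.sphere_nonempty.2 zero_le_one).to_subtype
  have : Nonempty (Metric.sphere (0 : EuclideanSpace ℝ (Fin m)) 1) :=
    (NormedSpace.sphere_nonempty.2 zero_le_one).to_subtype
  set D := TopologicalSpace.denseSeq (Metric.sphere (0 : EuclideanSpace ℝ (Fin n)) 1 ×
    Metric.sphere (0 : EuclideanSpace ℝ (Fin m)) 1) with hD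
  have hsph : ∀ {k : ℕ} (x : Metric.sphere (0 : EuclideanSpace ℝ (Fin k)) 1),
      ∑ a, x.1.ofLp a ^ 2 = 1 := fun x => by
    rw [← EuclideanSpace.real_norm_sq_eq x.1, mem_sphere_zero_iff_norm.1 x.2, one_pow]
  have key := stdGauss_bilin_gt_le hs (fun k => (D k).1.1.ofLp) (fun k => (D k).2.1.ofLp)
    (fun k => hsph _) fun k => hsph _
  have hmeas : MeasurableSet {g : Fin n × Fin m → ℝ | ∃ i, √(Fintype.card (Fin n)) +
      √(Fintype.card (Fin m)) + s <
      lin (fun i (q : Fin n × Fin m) => (D i).1.1.ofLp q.1 * (D i).2.1.ofLp q.2) g i} := by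
    rw [Set.ofPred_exists]
    exact MeasurableSet.iUnion fun i => measurableSet_lt measurable_const
      ((continuous_apply i).comp (continuous_lin
        fun i (q : Fin n × Fin m) => (D i).1.1.ofLp q.1 * (D i).2.1.ofLp q.2)).measurable
  rw [← hlaw, Measure.map_apply hGm hmeas] at key
  refine (measure_mono fun ω hω => ?_).trans key
  by_contra hcon
  simp only [Set.mem_preimage, Set.mem_ofPred_eq, not_exists, not_lt, Fintype.card_fin] at hcon
  refine not_le.2 hω (l2_opNorm_le_of_forall_bilin (by positivity) fun u v hu hv => ?_)
  set Φ : Metric.sphere (0 : EuclideanSpace ℝ (Fin n)) 1 ×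
      Metric.sphere (0 : EuclideanSpace ℝ (Fin m)) 1 → ℝ :=
    fun p => ∑ a, ∑ b, p.1.1.ofLp a * p.2.1.ofLp b * V ω a b with hΦ
  have hΦc : Continuous Φ := by fun_prop
  -- The bound along a countable dense sequence of pairs extends to all unit vectors, being a closed
  -- condition.
  have hcl : IsClosed {p | Φ p ≤ √c * (√n + √m + s)} := isClosed_le hΦc continuous_const
  have hall : ∀ p, Φ p ≤ √c * (√n + √m + s) := by
    intro p
    refine (TopologicalSpace.denseRange_denseSeq _).induction_on
      (p := fun p => Φ p ≤ √c * (√n + √m + s)) p hcl fun k => ?_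
    have h1 := hcon k
    have h2 : lin (fun i (q : Fin n × Fin m) => (D i).1.1.ofLp q.1 * (D i).2.1.ofLp q.2) (G ω) k =
        (√c)⁻¹ * Φ (D k) := by
      simp only [lin, hG, hΦ, Fintype.sum_prod_type, Finset.mul_sum]
      exact Finset.sum_congr rfl fun a _ => Finset.sum_congr rfl fun b _ => by ring
    rw [h2, inv_mul_le_iff₀ hc0] at h1
    exact h1
  have hunit : ∀ {k : ℕ} (x : Fin k → ℝ), ∑ a, x a ^ 2 = 1 →
      WithLp.toLp 2 x ∈ Metric.sphere (0 : EuclideanSpace ℝ (Fin k)) 1 := fun x hx => by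
    rw [mem_sphere_zero_iff_norm, EuclideanSpace.norm_eq]
    simp [hx]
  exact hall (⟨_, hunit u hu⟩, ⟨_, hunit v hv⟩)

end MatrixNorm

end SGM

/-! ### Gradients of the batch loss and their operator norms. -/

namespace SGM

open scoped Matrix.Norms.L2Operator

section MatrixNorms

variable {m n : ℕ}

lemma norm_toLp_mulVec_le (A : Matrix (Fin m) (Fin n) ℝ) (x : Fin n → ℝ) :
    ‖WithLp.toLp 2 (A *ᵥ x)‖ ≤ ‖A‖ * ‖WithLp.toLp 2 x‖ :=
  A.l2_opNorm_mulVec (WithLp.toLp 2 x)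

lemma l2_opNorm_transpose (A : Matrix (Fin m) (Fin n) ℝ) : ‖Aᵀ‖ = ‖A‖ := by
  rw [← Matrix.conjTranspose_eq_transpose_of_trivial, Matrix.l2_opNorm_conjTranspose]

lemma norm_toLp_le_of_abs_le {x y : Fin n → ℝ} (h : ∀ i, |x i| ≤ |y i|) :
    ‖WithLp.toLp 2 x‖ ≤ ‖WithLp.toLp 2 y‖ := by
  rw [EuclideanSpace.norm_eq, EuclideanSpace.norm_eq]
  exact Real.sqrt_le_sqrt (Finset.sum_le_sum fun i _ => by
    simpa using pow_le_pow_left₀ (abs_nonneg _) (h i) 2)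

lemma l2_opNorm_vecMulVec_le (x : Fin m → ℝ) (y : Fin n → ℝ) :
    ‖Matrix.vecMulVec x y‖ ≤ ‖WithLp.toLp 2 x‖ * ‖WithLp.toLp 2 y‖ := by
  refine l2_opNorm_le_of_forall_bilin (by positivity) fun u v hu hv => ?_
  have hnorm : ∀ {k : ℕ} (z : Fin k → ℝ), ‖WithLp.toLp 2 z‖ = √(∑ i, z i ^ 2) := fun z => by
    simp [EuclideanSpace.norm_eq]
  have h : ∑ a, ∑ b, u a * v b * Matrix.vecMulVec x y a b = (∑ a, u a * x a) * ∑ b, v b * y b := by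
    rw [Finset.sum_mul_sum]
    exact Finset.sum_congr rfl fun a _ => Finset.sum_congr rfl fun b _ => by
      rw [Matrix.vecMulVec_apply]; ring
  have h1 : |∑ a, u a * x a| ≤ ‖WithLp.toLp 2 x‖ := by
    refine (Real.abs_le_sqrt (Finset.sum_mul_sq_le_sq_mul_sq _ _ _)).trans_eq ?_
    rw [hu, one_mul, hnorm]
  have h2 : |∑ b, v b * y b| ≤ ‖WithLp.toLp 2 y‖ := by
    refine (Real.abs_le_sqrt (Finset.sum_mul_sq_le_sq_mul_sq _ _ _)).trans_eq ?_
    rw [hv, one_mul, hnorm]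
  rw [h]
  refine (le_abs_self _).trans ?_
  rw [abs_mul]
  exact mul_le_mul h1 h2 (abs_nonneg _) (norm_nonneg _)

lemma sq_frob (A : Matrix (Fin m) (Fin n) ℝ) : frob A ^ 2 = ∑ i, ∑ j, A i j ^ 2 :=
  Real.sq_sqrt (Finset.sum_nonneg fun _ _ => Finset.sum_nonneg fun _ _ => sq_nonneg _)

lemma l2_opNorm_le_frob (A : Matrix (Fin m) (Fin n) ℝ) : ‖A‖ ≤ frob A := by
  refine l2_opNorm_le_of_forall_bilin (Real.sqrt_nonneg _) fun u v hu hv => ?_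
  have h := Real.sum_mul_le_sqrt_mul_sqrt Finset.univ (fun q : Fin m × Fin n => u q.1 * v q.2)
    fun q => A q.1 q.2
  have h1 : ∑ q : Fin m × Fin n, (u q.1 * v q.2) ^ 2 = 1 := by
    simp only [mul_pow]
    rw [Fintype.sum_prod_type]
    simp only
    rw [← Finset.sum_mul_sum, hu, hv, one_mul]
  rw [h1, Real.sqrt_one, one_mul, Fintype.sum_prod_type, Fintype.sum_prod_type] at h
  exact h

end MatrixNorms

section Gradients

variable {din d dout k : ℕ} {l : Loss dout} {σ : ℝ → ℝ}

/-- The gradient of the loss in its first argument. -/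
noncomputable def lossGrad (l : Loss dout) (y₁ y₂ : EuclideanSpace ℝ (Fin dout)) : Fin dout → ℝ :=
  fun m => fderiv ℝ (fun p : EuclideanSpace ℝ (Fin dout) × EuclideanSpace ℝ (Fin dout) => l p.1 p.2)
    (y₁, y₂) (EuclideanSpace.single m 1, 0)

lemma AdmissibleLoss.hasDerivAt_comp (hl : AdmissibleLoss l) {y : ℝ → Fin dout → ℝ}
    {y' : Fin dout → ℝ} {t : ℝ} (hy : ∀ m, HasDerivAt (fun s => y s m) (y' m) t)
    (y₂ : EuclideanSpace ℝ (Fin dout)) :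
    HasDerivAt (fun s => l (WithLp.toLp 2 (y s)) y₂)
      (∑ m, y' m * lossGrad l (WithLp.toLp 2 (y t)) y₂ m) t := by
  have h1 : HasDerivAt (fun s => WithLp.toLp 2 (y s)) (WithLp.toLp 2 y') t :=
    (PiLp.hasFDerivAt_toLp (𝕜 := ℝ) 2 (y t)).comp_hasDerivAt t (hasDerivAt_pi.2 hy)
  have h2 := ((hl.contDiff.differentiable one_ne_zero).differentiableAt
    (x := (WithLp.toLp 2 (y t), y₂))).hasFDerivAt.comp_hasDerivAt t
    (h1.prodMk (hasDerivAt_const t y₂))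
  convert! h2 using 1
  have h3 : (WithLp.toLp 2 y', (0 : EuclideanSpace ℝ (Fin dout))) =
      ∑ m, y' m • ((EuclideanSpace.single m (1 : ℝ) : EuclideanSpace ℝ (Fin dout)),
        (0 : EuclideanSpace ℝ (Fin dout))) := by
    refine Prod.ext ?_ ?_
    · rw [Prod.fst_sum]
      ext i
      simp [WithLp.ofLp_sum, Finset.sum_apply, Pi.single_apply]
    · simp [Prod.snd_sum]
  rw [h3, map_sum]
  refine Finset.sum_congr rfl fun m _ => ?_
  rw [map_smul, smul_eq_mul]
  rfl

/-- Along the line in the direction of the gradient `G` itself, the loss has derivative `‖G‖ ^ 2`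
and Lipschitz constant `‖G‖`. -/
lemma AdmissibleLoss.norm_lossGrad_le (hl : AdmissibleLoss l)
    (y₁ y₂ : EuclideanSpace ℝ (Fin dout)) : ‖WithLp.toLp 2 (lossGrad l y₁ y₂)‖ ≤ 1 := by
  set G := lossGrad l y₁ y₂ with hG
  have h := hl.hasDerivAt_comp (y := fun s m => y₁ m + s * G m) (y' := G) (t := 0)
    (fun m => by simpa using ((hasDerivAt_id (0 : ℝ)).mul_const (G m)).const_add (y₁ m)) y₂
  have hlip : LipschitzWith ‖WithLp.toLp 2 G‖₊
      fun s : ℝ => l (WithLp.toLp 2 fun m => y₁ m + s * G m) y₂ := by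
    refine LipschitzWith.of_dist_le_mul fun s t => ?_
    refine ((hl.lipschitz_left y₂).dist_le_mul _ _).trans ?_
    rw [NNReal.coe_one, one_mul, dist_eq_norm, coe_nnnorm, mul_comm, Real.dist_eq,
      ← Real.norm_eq_abs, ← norm_smul]
    refine le_of_eq (congrArg _ ?_)
    ext m
    simp
    ring
  have h1 := norm_deriv_le_of_lipschitz (x₀ := (0 : ℝ)) hlip
  rw [h.deriv] at h1
  have e : (WithLp.toLp 2 fun m => y₁ m + 0 * G m) = y₁ := by ext m; simp
  have h2 : ∑ m, G m * lossGrad l y₁ y₂ m = ‖WithLp.toLp 2 G‖ ^ 2 := by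
    rw [EuclideanSpace.real_norm_sq_eq]
    exact Finset.sum_congr rfl fun m _ => by rw [← hG, sq]
  simp only [e] at h1
  rw [h2, Real.norm_eq_abs, abs_of_nonneg (sq_nonneg _), coe_nnnorm] at h1
  by_contra! hc
  nlinarith

/-- The gradient of the data term of the batch loss in the first layer. -/
noncomputable def dataGradV (l : Loss dout) (σ : ℝ → ℝ) (z : Fin k → Data din dout)
    (v : Matrix (Fin din) (Fin d) ℝ) (w : Matrix (Fin d) (Fin dout) ℝ) :
    Matrix (Fin din) (Fin d) ℝ :=
  (1 / (k : ℝ)) • ∑ r, Matrix.vecMulVec (z r).1.ofLp fun j =>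
    deriv σ ((vᵀ *ᵥ (z r).1.ofLp) j) * (w *ᵥ lossGrad l (network σ (z r).1 v w) (z r).2) j

/-- The gradient of the data term of the batch loss in the second layer. -/
noncomputable def dataGradW (l : Loss dout) (σ : ℝ → ℝ) (z : Fin k → Data din dout)
    (v : Matrix (Fin din) (Fin d) ℝ) (w : Matrix (Fin d) (Fin dout) ℝ) :
    Matrix (Fin d) (Fin dout) ℝ :=
  (1 / (k : ℝ)) • ∑ r, Matrix.vecMulVec (fun j => σ ((vᵀ *ᵥ (z r).1.ofLp) j))
    (lossGrad l (network σ (z r).1 v w) (z r).2)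

lemma hasDerivAt_sq_frob {m n : ℕ} (A : Matrix (Fin m) (Fin n) ℝ) (i : Fin m) (j : Fin n) :
    HasDerivAt (fun s : ℝ => frob (A + s • Matrix.single i j (1 : ℝ)) ^ 2) (2 * A i j) 0 := by
  simp only [sq_frob]
  have h : HasDerivAt
      (fun s : ℝ => ∑ a, ∑ b, (A + s • Matrix.single i j (1 : ℝ)) a b ^ 2)
      (∑ a, ∑ b, 2 * A a b * (Matrix.single i j (1 : ℝ) : Matrix _ _ ℝ) a b) 0 := by
    refine HasDerivAt.fun_sum fun a _ => HasDerivAt.fun_sum fun b _ => ?_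
    have : HasDerivAt (fun s : ℝ => A a b + s * (Matrix.single i j (1 : ℝ) : Matrix _ _ ℝ) a b)
        ((Matrix.single i j (1 : ℝ) : Matrix _ _ ℝ) a b) 0 := by
      simpa using ((hasDerivAt_id (0 : ℝ)).mul_const
        ((Matrix.single i j (1 : ℝ) : Matrix _ _ ℝ) a b)).const_add (A a b)
    convert! this.fun_pow 2 using 1
    simp
  convert! h using 1
  simp [Matrix.single_apply, ite_and]

lemma matGrad_batchLoss_fst (hk : 1 ≤ k) (hl : AdmissibleLoss l) (hσ : AdmissibleActivation σ)
    (lam : ℝ) (z : Fin k → Data din dout)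
    (v : Matrix (Fin din) (Fin d) ℝ) (w : Matrix (Fin d) (Fin dout) ℝ) :
    matGrad (fun v => batchLoss l σ lam z v w) v = lam • v + dataGradV l σ z v w := by
  ext i j
  have hpre : ∀ (x : EuclideanSpace ℝ (Fin din)) (j' : Fin d), HasDerivAt
      (fun s : ℝ => ((v + s • Matrix.single i j (1 : ℝ))ᵀ *ᵥ x.ofLp) j')
      (if j' = j then x i else 0) 0 := by
    intro x j'
    have e : (fun s : ℝ => ((v + s • Matrix.single i j (1 : ℝ))ᵀ *ᵥ x.ofLp) j') =
        fun s => (vᵀ *ᵥ x.ofLp) j' + s * (if j' = j then x i else 0) := by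
      funext s
      rw [Matrix.transpose_add, Matrix.add_mulVec, Matrix.transpose_smul, Matrix.smul_mulVec,
        Matrix.transpose_single, Pi.add_apply, Pi.smul_apply, smul_eq_mul]
      congr 2
      simp only [Matrix.mulVec, dotProduct, Matrix.single_apply, ite_and, ite_mul, one_mul,
        zero_mul]
      by_cases hj : j' = j
      · subst hj; simp
      · simp [hj, Ne.symm hj]
    rw [e]
    simpa using ((hasDerivAt_id (0 : ℝ)).mul_const (if j' = j then x i else 0)).const_add
      ((vᵀ *ᵥ x.ofLp) j')
  have hnet : ∀ (x : EuclideanSpace ℝ (Fin din)) (m : Fin dout), HasDerivAt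
      (fun s : ℝ => (wᵀ *ᵥ fun j' => σ (((v + s • Matrix.single i j (1 : ℝ))ᵀ *ᵥ x.ofLp) j')) m)
      (w j m * (deriv σ ((vᵀ *ᵥ x.ofLp) j) * x i)) 0 := by
    intro x m
    have h : HasDerivAt
        (fun s : ℝ => ∑ j', wᵀ m j' * σ (((v + s • Matrix.single i j (1 : ℝ))ᵀ *ᵥ x.ofLp) j'))
        (∑ j', wᵀ m j' * (deriv σ (((v + (0 : ℝ) • Matrix.single i j (1 : ℝ))ᵀ *ᵥ x.ofLp) j') *
          (if j' = j then x i else 0))) 0 :=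
      HasDerivAt.fun_sum fun j' _ => HasDerivAt.const_mul _
        (((hσ.contDiff.differentiable one_ne_zero).differentiableAt.hasDerivAt).comp 0 (hpre x j'))
    convert! h using 1
    simp
  have hreg : HasDerivAt (fun s : ℝ => lam / 2 *
      (frob (v + s • Matrix.single i j (1 : ℝ)) ^ 2 + frob w ^ 2)) (lam / 2 * (2 * v i j)) 0 :=
    ((hasDerivAt_sq_frob v i j).add_const _).const_mul _
  have htot : HasDerivAt (fun s : ℝ => batchLoss l σ lam z (v + s • Matrix.single i j (1 : ℝ)) w)
      (1 / (k : ℝ) * ∑ r, (∑ m, w j m * (deriv σ ((vᵀ *ᵥ (z r).1.ofLp) j) * (z r).1 i) *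
        lossGrad l (network σ (z r).1 v w) (z r).2 m + lam / 2 * (2 * v i j))) 0 := by
    refine HasDerivAt.const_mul _ (HasDerivAt.fun_sum fun r _ => ?_)
    have := (hl.hasDerivAt_comp (hnet (z r).1) (z r).2).add hreg
    convert! this using 1
    simp [network]
  rw [matGrad, Matrix.of_apply, htot.deriv]
  have hk0 : (k : ℝ) ≠ 0 := by positivity
  simp only [dataGradV, Matrix.add_apply, Matrix.smul_apply, smul_eq_mul, Matrix.sum_apply,
    Matrix.vecMulVec_apply, Finset.sum_add_distrib, Finset.sum_const, Finset.card_univ,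
    Fintype.card_fin, nsmul_eq_mul, mul_add]
  rw [add_comm]
  congr 1
  · field_simp
  · congr 1
    refine Finset.sum_congr rfl fun r _ => ?_
    simp only [Matrix.mulVec, dotProduct, Finset.mul_sum]
    exact Finset.sum_congr rfl fun m _ => by ring

lemma matGrad_batchLoss_snd (hk : 1 ≤ k) (hl : AdmissibleLoss l)
    (lam : ℝ) (z : Fin k → Data din dout)
    (v : Matrix (Fin din) (Fin d) ℝ) (w : Matrix (Fin d) (Fin dout) ℝ) :
    matGrad (fun w => batchLoss l σ lam z v w) w = lam • w + dataGradW l σ z v w := by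
  ext j m
  have hnet : ∀ (q : Fin d → ℝ) (m' : Fin dout), HasDerivAt
      (fun s : ℝ => ((w + s • Matrix.single j m (1 : ℝ))ᵀ *ᵥ q) m')
      (if m' = m then q j else 0) 0 := by
    intro q m'
    have e : (fun s : ℝ => ((w + s • Matrix.single j m (1 : ℝ))ᵀ *ᵥ q) m') =
        fun s => (wᵀ *ᵥ q) m' + s * (if m' = m then q j else 0) := by
      funext s
      rw [Matrix.transpose_add, Matrix.add_mulVec, Matrix.transpose_smul, Matrix.smul_mulVec,
        Matrix.transpose_single, Pi.add_apply, Pi.smul_apply, smul_eq_mul]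
      congr 2
      simp only [Matrix.mulVec, dotProduct, Matrix.single_apply, ite_and, ite_mul, one_mul,
        zero_mul]
      by_cases hj : m' = m
      · subst hj; simp
      · simp [hj, Ne.symm hj]
    rw [e]
    simpa using ((hasDerivAt_id (0 : ℝ)).mul_const (if m' = m then q j else 0)).const_add
      ((wᵀ *ᵥ q) m')
  have hreg : HasDerivAt (fun s : ℝ => lam / 2 *
      (frob v ^ 2 + frob (w + s • Matrix.single j m (1 : ℝ)) ^ 2)) (lam / 2 * (2 * w j m)) 0 :=
    ((hasDerivAt_sq_frob w j m).const_add _).const_mul _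
  have htot : HasDerivAt (fun s : ℝ => batchLoss l σ lam z v (w + s • Matrix.single j m (1 : ℝ)))
      (1 / (k : ℝ) * ∑ r, (σ ((vᵀ *ᵥ (z r).1.ofLp) j) *
        lossGrad l (network σ (z r).1 v w) (z r).2 m + lam / 2 * (2 * w j m))) 0 := by
    refine HasDerivAt.const_mul _ (HasDerivAt.fun_sum fun r _ => ?_)
    have := (hl.hasDerivAt_comp
      (hnet fun j' => σ ((vᵀ *ᵥ (z r).1.ofLp) j')) (z r).2).add hreg
    convert! this using 1
    simp [network]
  rw [matGrad, Matrix.of_apply, htot.deriv]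
  have hk0 : (k : ℝ) ≠ 0 := by positivity
  simp only [dataGradW, Matrix.add_apply, Matrix.smul_apply, smul_eq_mul, Matrix.sum_apply,
    Matrix.vecMulVec_apply, Finset.sum_add_distrib, Finset.sum_const, Finset.card_univ,
    Fintype.card_fin, nsmul_eq_mul, mul_add]
  rw [add_comm]
  congr 1
  field_simp

lemma AdmissibleActivation.abs_le (hσ : AdmissibleActivation σ) (x : ℝ) : |σ x| ≤ |x| := by
  have := hσ.lipschitz.dist_le_mul x 0
  simpa [hσ.map_zero] using this

lemma AdmissibleActivation.abs_deriv_le (hσ : AdmissibleActivation σ) (x : ℝ) :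
    |deriv σ x| ≤ 1 := by
  simpa using norm_deriv_le_of_lipschitz (x₀ := x) hσ.lipschitz

lemma norm_hidden_le (hσ : AdmissibleActivation σ) (x : EuclideanSpace ℝ (Fin din))
    (v : Matrix (Fin din) (Fin d) ℝ) :
    ‖WithLp.toLp 2 fun j => σ ((vᵀ *ᵥ x.ofLp) j)‖ ≤ ‖v‖ * ‖x‖ := by
  refine (norm_toLp_le_of_abs_le fun j => hσ.abs_le _).trans ?_
  have := norm_toLp_mulVec_le vᵀ x.ofLp
  rwa [l2_opNorm_transpose] at this

lemma norm_network_le (hσ : AdmissibleActivation σ) (x : EuclideanSpace ℝ (Fin din))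
    (v : Matrix (Fin din) (Fin d) ℝ) (w : Matrix (Fin d) (Fin dout) ℝ) :
    ‖network σ x v w‖ ≤ ‖v‖ * ‖w‖ * ‖x‖ := by
  have h := norm_toLp_mulVec_le wᵀ fun j => σ ((vᵀ *ᵥ x.ofLp) j)
  rw [l2_opNorm_transpose] at h
  refine h.trans ?_
  calc _ ≤ ‖w‖ * (‖v‖ * ‖x‖) :=
        mul_le_mul_of_nonneg_left (norm_hidden_le hσ x v) (norm_nonneg _)
    _ = _ := by ring

lemma norm_average_le {m n : ℕ} (hk : 1 ≤ k) {A : Fin k → Matrix (Fin m) (Fin n) ℝ} {K : ℝ}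
    (hA : ∀ r, ‖A r‖ ≤ K) : ‖(1 / (k : ℝ)) • ∑ r, A r‖ ≤ K := by
  have hk0 : (0 : ℝ) < k := by positivity
  rw [norm_smul, Real.norm_eq_abs, abs_of_pos (by positivity), one_div, inv_mul_le_iff₀ hk0]
  refine (norm_sum_le _ _).trans ((Finset.sum_le_card_nsmul _ _ K fun r _ => hA r).trans_eq ?_)
  simp

/-- Each summand is the outer product of an input of norm at most one with `w` applied to the loss
gradient, damped entrywise by `|σ'| ≤ 1`. -/
lemma norm_dataGradV_le (hk : 1 ≤ k) (hl : AdmissibleLoss l) (hσ : AdmissibleActivation σ)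
    {z : Fin k → Data din dout} (hz : ∀ r, ‖(z r).1‖ ≤ 1)
    (v : Matrix (Fin din) (Fin d) ℝ) (w : Matrix (Fin d) (Fin dout) ℝ) :
    ‖dataGradV l σ z v w‖ ≤ ‖w‖ := by
  refine norm_average_le hk fun r => (l2_opNorm_vecMulVec_le _ _).trans ?_
  refine (mul_le_of_le_one_left (norm_nonneg _) (hz r)).trans ?_
  refine (norm_toLp_le_of_abs_le (y := w *ᵥ lossGrad l (network σ (z r).1 v w) (z r).2)
    fun j => ?_).trans ?_
  · rw [abs_mul]
    exact mul_le_of_le_one_left (abs_nonneg _) (hσ.abs_deriv_le _)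
  · exact (norm_toLp_mulVec_le _ _).trans
      (mul_le_of_le_one_right (norm_nonneg _) (hl.norm_lossGrad_le _ _))

lemma norm_dataGradW_le (hk : 1 ≤ k) (hl : AdmissibleLoss l) (hσ : AdmissibleActivation σ)
    {z : Fin k → Data din dout} (hz : ∀ r, ‖(z r).1‖ ≤ 1)
    (v : Matrix (Fin din) (Fin d) ℝ) (w : Matrix (Fin d) (Fin dout) ℝ) :
    ‖dataGradW l σ z v w‖ ≤ ‖v‖ := by
  refine norm_average_le hk fun r => (l2_opNorm_vecMulVec_le _ _).trans ?_
  refine (mul_le_of_le_one_right (norm_nonneg _) (hl.norm_lossGrad_le _ _)).trans ?_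
  exact (norm_hidden_le hσ _ v).trans (mul_le_of_le_one_right (norm_nonneg _) (hz r))

end Gradients

/-! ### Growth of the norms during training. -/

section Iterates

variable {din d dout k T : ℕ} {l : Loss dout} {σ : ℝ → ℝ} {lam : ℝ} {ηV ηW : ℕ → ℝ}
  {v₀ : Matrix (Fin din) (Fin d) ℝ} {w₀ : Matrix (Fin d) (Fin dout) ℝ}
  {z : ℕ → Fin k → Data din dout}

lemma norm_sub_smul_add_le {m n : ℕ} {A D : Matrix (Fin m) (Fin n) ℝ} {η K : ℝ} (hη : 0 ≤ η)
    (hηl : η * lam ≤ 1) (hD : ‖D‖ ≤ K) :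
    ‖A - η • (lam • A + D)‖ ≤ (1 - η * lam) * ‖A‖ + η * K := by
  have e : A - η • (lam • A + D) = (1 - η * lam) • A - η • D := by
    rw [smul_add, sub_smul, one_smul, mul_smul]
    abel
  rw [e]
  refine (norm_sub_le _ _).trans ?_
  rw [norm_smul, norm_smul, Real.norm_eq_abs, Real.norm_eq_abs, abs_of_nonneg hη,
    abs_of_nonneg (by linarith)]
  gcongr

lemma iterates_snd_eq (h : ∀ t < T, ηW t = 0) :
    ∀ t ≤ T, (iterates l σ lam ηV ηW v₀ w₀ z t).2 = w₀ := by
  intro t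
  induction t with
  | zero => exact fun _ => rfl
  | succ t ih =>
    intro ht
    simp only [iterates]
    rw [h t (by omega), zero_smul, sub_zero, ih (by omega)]

/-- One step gives `a' ≤ (1 - η * lam) * a + η * lam * (‖w₀‖ / lam)`, a convex combination of the
current norm and the equilibrium value `‖w₀‖ / lam`. -/
lemma norm_iterates_fst_le (hk : 1 ≤ k) (hl : AdmissibleLoss l) (hσ : AdmissibleActivation σ)
    (hlam : 0 < lam) (hη : ∀ t < T, 0 ≤ ηV t ∧ ηV t ≤ 1 / lam)
    (hz : ∀ t < T, ∀ r, ‖(z t r).1‖ ≤ 1) (hW : ∀ t < T, ηW t = 0) :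
    ∀ t ≤ T, ‖(iterates l σ lam ηV ηW v₀ w₀ z t).1‖ ≤
      ‖v₀‖ * ∏ s ∈ Finset.range t, (1 - ηV s * lam) +
        ‖w₀‖ / lam * (1 - ∏ s ∈ Finset.range t, (1 - ηV s * lam)) := by
  intro t
  induction t with
  | zero => exact fun _ => by simp [iterates]
  | succ t ih =>
    intro ht
    have h2 := iterates_snd_eq (l := l) (σ := σ) (lam := lam) (ηV := ηV) (v₀ := v₀) (w₀ := w₀)
      (z := z) hW t (by omega)
    have hηt := hη t (by omega)
    have hηl : ηV t * lam ≤ 1 := by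
      have := mul_le_mul_of_nonneg_right hηt.2 hlam.le
      rwa [one_div, inv_mul_cancel₀ hlam.ne'] at this
    simp only [iterates]
    rw [matGrad_batchLoss_fst hk hl hσ]
    refine (norm_sub_smul_add_le hηt.1 hηl
      (norm_dataGradV_le hk hl hσ (hz t (by omega)) _ _)).trans ?_
    rw [h2, Finset.prod_range_succ]
    refine (add_le_add_left (mul_le_mul_of_nonneg_left (ih (by omega))
      (sub_nonneg.2 hηl)) _).trans_eq ?_
    field_simp
    ring

/-- Each layer's data gradient is bounded by the norm of the other layer, so with equal rates the
sum of the norms obeys a closed recursion with factor `(1 - η * lam) + η`. -/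
lemma norm_iterates_add_le (hk : 1 ≤ k) (hl : AdmissibleLoss l) (hσ : AdmissibleActivation σ)
    (hlam : 0 < lam) (hη : ∀ t < T, 0 ≤ ηV t ∧ ηV t ≤ 1 / lam)
    (hz : ∀ t < T, ∀ r, ‖(z t r).1‖ ≤ 1) (hW : ∀ t < T, ηW t = ηV t) :
    ∀ t ≤ T, ‖(iterates l σ lam ηV ηW v₀ w₀ z t).1‖ + ‖(iterates l σ lam ηV ηW v₀ w₀ z t).2‖ ≤
      (‖v₀‖ + ‖w₀‖) * ∏ s ∈ Finset.range t, (1 + (1 - lam) * ηV s) := by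
  intro t
  induction t with
  | zero => exact fun _ => by simp [iterates]
  | succ t ih =>
    intro ht
    have hηt := hη t (by omega)
    have hηl : ηV t * lam ≤ 1 := by
      have := mul_le_mul_of_nonneg_right hηt.2 hlam.le
      rwa [one_div, inv_mul_cancel₀ hlam.ne'] at this
    simp only [iterates]
    rw [matGrad_batchLoss_fst hk hl hσ, matGrad_batchLoss_snd hk hl, hW t (by omega)]
    refine (add_le_add (norm_sub_smul_add_le hηt.1 hηl
      (norm_dataGradV_le hk hl hσ (hz t (by omega)) _ _)) (norm_sub_smul_add_le hηt.1 hηl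
      (norm_dataGradW_le hk hl hσ (hz t (by omega)) _ _))).trans ?_
    rw [Finset.prod_range_succ, ← mul_assoc]
    have h0 : 0 ≤ 1 + (1 - lam) * ηV t := by linarith [hηt.1]
    refine le_trans (le_of_eq ?_) (mul_le_mul_of_nonneg_right (ih (by omega)) h0)
    ring

lemma iterates_congr {z' : ℕ → Fin k → Data din dout} :
    ∀ t, (∀ s < t, z s = z' s) →
      iterates l σ lam ηV ηW v₀ w₀ z t = iterates l σ lam ηV ηW v₀ w₀ z' t := by
  intro t
  induction t with
  | zero => exact fun _ => rfl
  | succ t ih =>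
    intro h
    simp only [iterates]
    rw [ih fun s hs => h s (by omega), h t (by omega)]

end Iterates

end SGM

/-! ### Measurability, and the generalization error given a norm bound. -/

namespace SGM

section Continuity

variable {din d dout k n : ℕ} {l : Loss dout} {σ : ℝ → ℝ}

lemma AdmissibleLoss.continuous (hl : AdmissibleLoss l) :
    Continuous fun p : EuclideanSpace ℝ (Fin dout) × EuclideanSpace ℝ (Fin dout) => l p.1 p.2 :=
  hl.contDiff.continuous

lemma AdmissibleLoss.continuous_lossGrad (hl : AdmissibleLoss l) :
    Continuous fun p : EuclideanSpace ℝ (Fin dout) × EuclideanSpace ℝ (Fin dout) =>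
      lossGrad l p.1 p.2 :=
  continuous_pi fun _ => (hl.contDiff.continuous_fderiv one_ne_zero).clm_apply continuous_const

variable {X : Type*} [TopologicalSpace X] {x : X → EuclideanSpace ℝ (Fin din)}
  {z : X → Fin k → Data din dout} {v : X → Matrix (Fin din) (Fin d) ℝ}
  {w : X → Matrix (Fin d) (Fin dout) ℝ}

lemma continuous_hidden (hσ : Continuous σ) (hx : Continuous x) (hv : Continuous v) :
    Continuous fun q => fun j => σ (((v q)ᵀ *ᵥ (x q).ofLp) j) := by
  have h : Continuous fun q => (v q)ᵀ *ᵥ (x q).ofLp :=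
    hv.matrix_transpose.matrix_mulVec ((PiLp.continuous_ofLp 2 _).comp hx)
  exact continuous_pi fun j => hσ.comp ((continuous_apply j).comp h)

lemma continuous_network (hσ : Continuous σ) (hx : Continuous x) (hv : Continuous v)
    (hw : Continuous w) : Continuous fun q => network σ (x q) (v q) (w q) :=
  (PiLp.continuous_toLp 2 _).comp (hw.matrix_transpose.matrix_mulVec (continuous_hidden hσ hx hv))

lemma continuous_dataGradV (hl : AdmissibleLoss l) (hσ : AdmissibleActivation σ)
    (hz : Continuous z) (hv : Continuous v) (hw : Continuous w) :
    Continuous fun q => dataGradV l σ (z q) (v q) (w q) := by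
  have hz1 : ∀ r, Continuous fun q => (z q r).1 := fun r => continuous_fst.comp
    ((continuous_apply r).comp hz)
  have hz2 : ∀ r, Continuous fun q => (z q r).2 := fun r => continuous_snd.comp
    ((continuous_apply r).comp hz)
  refine Continuous.const_smul (continuous_finsetSum _ fun r _ => ?_) (1 / (k : ℝ))
  refine Continuous.matrix_vecMulVec ((PiLp.continuous_ofLp 2 _).comp (hz1 r))
    (continuous_pi fun j => Continuous.mul ?_ ?_)
  · exact (continuous_apply j).comp
      (continuous_hidden (hσ.contDiff.continuous_deriv le_rfl) (hz1 r) hv)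
  · exact (continuous_apply j).comp (hw.matrix_mulVec (hl.continuous_lossGrad.comp
      ((continuous_network hσ.lipschitz.continuous (hz1 r) hv hw).prodMk (hz2 r))))

lemma continuous_dataGradW (hl : AdmissibleLoss l) (hσ : AdmissibleActivation σ)
    (hz : Continuous z) (hv : Continuous v) (hw : Continuous w) :
    Continuous fun q => dataGradW l σ (z q) (v q) (w q) := by
  have hz1 : ∀ r, Continuous fun q => (z q r).1 := fun r => continuous_fst.comp
    ((continuous_apply r).comp hz)
  have hz2 : ∀ r, Continuous fun q => (z q r).2 := fun r => continuous_snd.comp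
    ((continuous_apply r).comp hz)
  refine Continuous.const_smul (continuous_finsetSum _ fun r _ => ?_) (1 / (k : ℝ))
  exact Continuous.matrix_vecMulVec (continuous_hidden hσ.lipschitz.continuous (hz1 r) hv)
    (hl.continuous_lossGrad.comp
      ((continuous_network hσ.lipschitz.continuous (hz1 r) hv hw).prodMk (hz2 r)))

/-- The explicit gradients involve only first derivatives of `l` and `σ`, which are continuous.
Hence the trained parameters depend measurably on initialization and batches, and inherit
independence from the test sample. -/
lemma continuous_iterates (hk : 1 ≤ k) (hl : AdmissibleLoss l) (hσ : AdmissibleActivation σ)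
    (lam : ℝ) (ηV ηW : ℕ → ℝ) {z : X → ℕ → Fin k → Data din dout} (hz : ∀ t, Continuous fun q => z q t)
    (hv : Continuous v) (hw : Continuous w) (t : ℕ) :
    Continuous fun q => iterates l σ lam ηV ηW (v q) (w q) (z q) t := by
  induction t with
  | zero => exact hv.prodMk hw
  | succ t ih =>
    simp only [iterates, matGrad_batchLoss_fst hk hl hσ, matGrad_batchLoss_snd hk hl]
    exact (ih.fst.sub (((ih.fst.const_smul lam).add
        (continuous_dataGradV hl hσ (hz t) ih.fst ih.snd)).const_smul (ηV t))).prodMk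
      (ih.snd.sub (((ih.snd.const_smul lam).add
        (continuous_dataGradW hl hσ (hz t) ih.fst ih.snd)).const_smul (ηW t)))

lemma measurable_genError (ρ : Measure (Data din dout)) [IsProbabilityMeasure ρ]
    (hl : AdmissibleLoss l) (hσ : AdmissibleActivation σ) :
    Measurable fun p : (Fin n → Data din dout) ×
        ((Fin din → Fin d → ℝ) × (Fin d → Fin dout → ℝ)) =>
      genError ρ l σ p.1 (Matrix.of p.2.1) (Matrix.of p.2.2) := by
  have h1 : Measurable fun u : (Fin din → Fin d → ℝ) × (Fin d → Fin dout → ℝ) =>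
      ∫ q, l (network σ q.1 (Matrix.of u.1) (Matrix.of u.2)) q.2 ∂ρ := by
    have hc : Continuous fun p : ((Fin din → Fin d → ℝ) × (Fin d → Fin dout → ℝ)) ×
        Data din dout => l (network σ p.2.1 (Matrix.of p.1.1) (Matrix.of p.1.2)) p.2.2 :=
      hl.continuous.comp ((continuous_network hσ.lipschitz.continuous
        continuous_snd.fst continuous_fst.fst continuous_fst.snd).prodMk continuous_snd.snd)
    exact (hc.stronglyMeasurable.integral_prod_right (ν := ρ)).measurable
  have h2 : Continuous fun p : (Fin n → Data din dout) ×
      ((Fin din → Fin d → ℝ) × (Fin d → Fin dout → ℝ)) =>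
      1 / (n : ℝ) * ∑ i, l (network σ (p.1 i).1 (Matrix.of p.2.1) (Matrix.of p.2.2)) (p.1 i).2 := by
    refine continuous_const.mul (continuous_finsetSum _ fun i _ => ?_)
    have hi : Continuous fun p : (Fin n → Data din dout) ×
      ((Fin din → Fin d → ℝ) × (Fin d → Fin dout → ℝ)) => p.1 i :=
      (continuous_apply i).comp continuous_fst
    exact hl.continuous.comp ((continuous_network hσ.lipschitz.continuous
        hi.fst continuous_snd.fst continuous_snd.snd).prodMk hi.snd)
  exact (h1.comp measurable_snd).sub h2.measurable

end Continuity

open scoped Matrix.Norms.L2Operator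

section Generalization

lemma ae_norm_le_one {din dout : ℕ} {ρ : Measure (Data din dout)}
    (hρ : ρ.support ⊆ {z | max ‖z.1‖ ‖z.2‖ ≤ 1}) :
    ∀ᵐ z ∂ρ, ‖z.1‖ ≤ 1 ∧ ‖z.2‖ ≤ 1 := by
  filter_upwards [Measure.support_mem_ae (μ := ρ)] with z hz
  exact max_le_iff.1 (hρ hz)

variable {din d dout n : ℕ} {ρ : Measure (Data din dout)} [IsProbabilityMeasure ρ]
  {l : Loss dout} {σ : ℝ → ℝ}

lemma abs_loss_network_le (hl : AdmissibleLoss l) (hσ : AdmissibleActivation σ)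
    {z : Data din dout} (hz : ‖z.1‖ ≤ 1 ∧ ‖z.2‖ ≤ 1)
    (v : Matrix (Fin din) (Fin d) ℝ) (w : Matrix (Fin d) (Fin dout) ℝ) :
    |l (network σ z.1 v w) z.2| ≤ 1 + ‖v‖ * ‖w‖ := by
  have h := (hl.lipschitz_left z.2).dist_le_mul (network σ z.1 v w) z.2
  rw [hl.self_eq_zero _ hz.2, NNReal.coe_one, one_mul, Real.dist_eq, sub_zero, dist_eq_norm] at h
  have h1 : ‖network σ z.1 v w‖ ≤ ‖v‖ * ‖w‖ :=
    (norm_network_le hσ z.1 v w).trans (mul_le_of_le_one_right (by positivity) hz.1)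
  linarith [norm_sub_le (network σ z.1 v w) z.2, hz.2]

/-- Hoeffding's inequality for the generalization error at fixed parameters. -/
lemma pi_genError_gt_le (hρ : ρ.support ⊆ {z | max ‖z.1‖ ‖z.2‖ ≤ 1}) (hn : 1 ≤ n)
    (hl : AdmissibleLoss l) (hσ : AdmissibleActivation σ)
    {v : Matrix (Fin din) (Fin d) ℝ} {w : Matrix (Fin d) (Fin dout) ℝ} {R ζ : ℝ}
    (hR : ‖v‖ * ‖w‖ ≤ R) (hζ0 : 0 < ζ) (hζ1 : ζ < 1) :
    (Measure.pi fun _ : Fin n => ρ) {z | (1 + R) * √(2 / n * Real.log (4 / ζ)) <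
      |genError ρ l σ z v w|} ≤ ENNReal.ofReal (ζ / 2) := by
  have hR0 : 0 ≤ R := le_trans (by positivity) hR
  have hn0 : (0 : ℝ) < n := by positivity
  set L := Real.log (4 / ζ) with hL
  have hL0 : 0 < L := Real.log_pos (by rw [lt_div_iff₀ hζ0]; linarith)
  set ε := (1 + R) * √(2 / n * L) with hε
  have hε0 : 0 ≤ ε := by positivity
  set f : Data din dout → ℝ := fun p => l (network σ p.1 v w) p.2 with hf
  have hfc : Continuous f := hl.continuous.comp ((continuous_network hσ.lipschitz.continuous
    continuous_fst continuous_const continuous_const).prodMk continuous_snd)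
  set μ := Measure.pi fun _ : Fin n => ρ with hμ
  -- Hoeffding's lemma on the interval `[-(1 + R), 1 + R]`: the variance proxy is `(1 + R) ^ 2`.
  have hsub : HasSubgaussianMGF (fun p => f p - ∫ p, f p ∂ρ) ((‖(1 + R) - -(1 + R)‖₊ / 2) ^ 2) ρ := by
    refine hasSubgaussianMGF_of_mem_Icc hfc.measurable.aemeasurable ?_
    filter_upwards [ae_norm_le_one hρ] with p hp
    exact abs_le.1 ((abs_loss_network_le hl hσ hp v w).trans (by linarith))
  have hsubi : ∀ i : Fin n, HasSubgaussianMGF (fun z : Fin n → Data din dout =>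
      f (z i) - ∫ p, f p ∂ρ) ((‖(1 + R) - -(1 + R)‖₊ / 2) ^ 2) μ := fun i => by
    refine HasSubgaussianMGF.of_map (Y := fun z : Fin n → Data din dout => z i)
      (X := fun p => f p - ∫ p, f p ∂ρ) (measurable_pi_apply i).aemeasurable ?_
    rwa [hμ, (measurePreserving_eval (fun _ : Fin n => ρ) i).map_eq]
  have hind : iIndepFun (fun (i : Fin n) (z : Fin n → Data din dout) => f (z i) - ∫ p, f p ∂ρ) μ :=
    iIndepFun_pi (X := fun _ p => f p - ∫ p, f p ∂ρ) fun _ =>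
      (hfc.measurable.sub_const _).aemeasurable
  have hindneg : iIndepFun (fun (i : Fin n) (z : Fin n → Data din dout) =>
      -(f (z i) - ∫ p, f p ∂ρ)) μ :=
    hind.comp (fun _ x => -x) fun _ => measurable_neg
  -- `ε` is chosen so that each one-sided tail is exactly `ζ / 4`.
  have hexp : Real.exp (-(n * ε) ^ 2 / (2 *
      ∑ _i : Fin n, (((‖(1 + R) - -(1 + R)‖₊ / 2) ^ 2 : ℝ≥0) : ℝ))) = ζ / 4 := by
    have h1 : (((‖(1 + R) - -(1 + R)‖₊ / 2) ^ 2 : ℝ≥0) : ℝ) = (1 + R) ^ 2 := by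
      push_cast
      rw [Real.norm_eq_abs, abs_of_nonneg (by linarith)]
      ring
    have h2 : ε ^ 2 = (1 + R) ^ 2 * (2 / n * L) := by
      rw [hε, mul_pow, Real.sq_sqrt (by positivity)]
    have h3 : -(n * ε) ^ 2 / (2 * ∑ _i : Fin n, (1 + R) ^ 2) = -L := by
      rw [Finset.sum_const, Finset.card_univ, Fintype.card_fin, nsmul_eq_mul, mul_pow, h2]
      have : 1 + R ≠ 0 := by positivity
      field_simp
    rw [h1, h3, hL, ← Real.log_inv, Real.exp_log (by positivity), inv_div]
  have hup := HasSubgaussianMGF.measure_sum_ge_le_of_iIndepFun hind (s := Finset.univ)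
    (fun i _ => hsubi i) (ε := n * ε) (by positivity)
  have hlo := HasSubgaussianMGF.measure_sum_ge_le_of_iIndepFun hindneg (s := Finset.univ)
    (fun i _ => (hsubi i).neg) (ε := n * ε) (by positivity)
  push_cast at hup hlo hexp
  rw [hexp] at hup hlo
  have hsubset : {z : Fin n → Data din dout | ε < |genError ρ l σ z v w|} ⊆
      {z | n * ε ≤ ∑ i, (f (z i) - ∫ p, f p ∂ρ)} ∪ {z | n * ε ≤ ∑ i, -(f (z i) - ∫ p, f p ∂ρ)} := by
    intro z hz
    have hgen : n * genError ρ l σ z v w = ∑ i, -(f (z i) - ∫ p, f p ∂ρ) := by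
      rw [Finset.sum_neg_distrib, Finset.sum_sub_distrib, Finset.sum_const, Finset.card_univ,
        Fintype.card_fin, nsmul_eq_mul, genError, mul_sub, ← mul_assoc, mul_one_div_cancel hn0.ne']
      ring
    have hz' : ε < |genError ρ l σ z v w| := hz
    rcases lt_abs.1 hz' with h | h
    · right
      change n * ε ≤ ∑ i, -(f (z i) - ∫ p, f p ∂ρ)
      rw [← hgen]
      exact mul_le_mul_of_nonneg_left h.le hn0.le
    · left
      change n * ε ≤ ∑ i, (f (z i) - ∫ p, f p ∂ρ)
      have := mul_le_mul_of_nonneg_left h.le hn0.le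
      rw [mul_neg, hgen, Finset.sum_neg_distrib, neg_neg] at this
      exact this
  rw [ENNReal.le_ofReal_iff_toReal_le (measure_ne_top _ _) (by positivity)]
  refine (measureReal_mono hsubset).trans ((measureReal_union_le _ _).trans ?_)
  linarith

/-- By independence, the joint law of test sample and parameters is a product, so the Hoeffding
bound holds slice by slice. The failure probability splits into `ζ / 2` for the sample and `ζ / 2`
for the size of the parameters. -/
lemma one_sub_le_prob_genError_le {Ω : Type*} [MeasurableSpace Ω] {P : Measure Ω}
    [IsProbabilityMeasure P] (hρ : ρ.support ⊆ {z | max ‖z.1‖ ‖z.2‖ ≤ 1}) (hn : 1 ≤ n)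
    (hl : AdmissibleLoss l) (hσ : AdmissibleActivation σ)
    {Z : Fin n → Ω → Data din dout} (hZ : IIDSample P ρ Z)
    {V : Ω → Matrix (Fin din) (Fin d) ℝ} {W : Ω → Matrix (Fin d) (Fin dout) ℝ}
    {U : Ω → (Fin din → Fin d → ℝ) × (Fin d → Fin dout → ℝ)}
    (hU : Measurable U) (hind : IndepFun (fun ω i => Z i ω) U P)
    (hVW : ∀ ω, U ω = (Matrix.of.symm (V ω), Matrix.of.symm (W ω))) {R ζ : ℝ}
    (hR : P {ω | R < ‖V ω‖ * ‖W ω‖} ≤ ENNReal.ofReal (ζ / 2)) (hζ0 : 0 < ζ) (hζ1 : ζ < 1) :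
    1 - ζ ≤ P.real {ω | |genError ρ l σ (fun i => Z i ω) (V ω) (W ω)| ≤
      (1 + R) * √(2 / n * Real.log (4 / ζ))} := by
  set ε := (1 + R) * √(2 / n * Real.log (4 / ζ)) with hε
  set Z' : Ω → Fin n → Data din dout := fun ω i => Z i ω with hZ'
  have hZm : Measurable Z' := measurable_pi_lambda _ hZ.measurable
  have hlaw : P.map Z' = Measure.pi fun _ => ρ := by
    rw [hZ', (iIndepFun_iff_map_fun_eq_pi_map fun i => (hZ.measurable i).aemeasurable).1 hZ.indep]
    simp only [hZ.law]
  -- The norm constraint is built into the bad set: slices at large parameters are empty, and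
  -- Hoeffding applies with the same `R` on all others.
  set B : Set ((Fin n → Data din dout) × ((Fin din → Fin d → ℝ) × (Fin d → Fin dout → ℝ))) :=
    {p | ‖(Matrix.of p.2.1 : Matrix (Fin din) (Fin d) ℝ)‖ *
      ‖(Matrix.of p.2.2 : Matrix (Fin d) (Fin dout) ℝ)‖ ≤ R} ∩
    {p | ε < |genError ρ l σ p.1 (Matrix.of p.2.1) (Matrix.of p.2.2)|} with hB
  have hBm : MeasurableSet B := by
    refine MeasurableSet.inter (measurableSet_le ?_ measurable_const)
      (measurableSet_lt measurable_const (measurable_genError ρ hl hσ).abs)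
    refine Continuous.measurable (Continuous.mul ?_ ?_)
    · exact (continuous_norm (E := Matrix (Fin din) (Fin d) ℝ)).comp
        (continuous_fst.comp continuous_snd)
    · exact (continuous_norm (E := Matrix (Fin d) (Fin dout) ℝ)).comp
        (continuous_snd.comp continuous_snd)
  have hPB : P {ω | (Z' ω, U ω) ∈ B} ≤ ENNReal.ofReal (ζ / 2) := by
    have hmap := (indepFun_iff_map_prod_eq_prod_map_map hZm.aemeasurable hU.aemeasurable).1 hind
    have h1 : P {ω | (Z' ω, U ω) ∈ B} = P.map (fun ω => (Z' ω, U ω)) B :=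
      (Measure.map_apply (hZm.prodMk hU) hBm).symm
    have : IsProbabilityMeasure (P.map U) := Measure.isProbabilityMeasure_map hU.aemeasurable
    rw [h1, hmap, hlaw, Measure.prod_apply_symm hBm]
    calc _ ≤ ∫⁻ _, ENNReal.ofReal (ζ / 2) ∂P.map U := by
          refine lintegral_mono fun u => ?_
          by_cases hu : ‖(Matrix.of u.1 : Matrix (Fin din) (Fin d) ℝ)‖ *
              ‖(Matrix.of u.2 : Matrix (Fin d) (Fin dout) ℝ)‖ ≤ R
          · exact (measure_mono fun z hz => hz.2).trans
              (pi_genError_gt_le hρ hn hl hσ hu hζ0 hζ1)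
          · refine (measure_mono_null (fun z hz => hu hz.1) measure_empty).le.trans zero_le
      _ = _ := by simp
  set A := {ω | |genError ρ l σ (fun i => Z i ω) (V ω) (W ω)| ≤ ε} with hA
  have hcov : (Set.univ : Set Ω) ⊆ A ∪ ({ω | (Z' ω, U ω) ∈ B} ∪ {ω | R < ‖V ω‖ * ‖W ω‖}) := by
    intro ω _
    by_cases h1 : ω ∈ A
    · exact Or.inl h1
    · right
      by_cases h2 : R < ‖V ω‖ * ‖W ω‖
      · exact Or.inr h2
      · left
        change (Z' ω, U ω) ∈ B
        rw [hVW]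
        refine ⟨not_lt.1 h2, ?_⟩
        change ε < |genError ρ l σ (fun i => Z i ω) (V ω) (W ω)|
        exact not_le.1 h1
  have h1 : (1 : ℝ) ≤ P.real A + (P.real {ω | (Z' ω, U ω) ∈ B} +
      P.real {ω | R < ‖V ω‖ * ‖W ω‖}) := by
    rw [← probReal_univ (μ := P)]
    exact (measureReal_mono hcov).trans ((measureReal_union_le _ _).trans
      (add_le_add_right (measureReal_union_le _ _) _))
  have h2 : P.real {ω | (Z' ω, U ω) ∈ B} ≤ ζ / 2 :=
    ENNReal.toReal_le_of_le_ofReal (by positivity) hPB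
  have h3 : P.real {ω | R < ‖V ω‖ * ‖W ω‖} ≤ ζ / 2 :=
    ENNReal.toReal_le_of_le_ofReal (by positivity) hR
  linarith

end Generalization

end SGM

/-! ### The constants `C3` and `C5`, and the conclusion. -/

namespace SGM

open scoped Matrix.Norms.L2Operator

section Training

variable {din d dout k T : ℕ}

/-- Extension of `T` batches to a sequence of batches. -/
noncomputable def extendBatches (z : Fin T → Fin k → Data din dout) (t : ℕ) : Fin k → Data din dout :=
  if h : t < T then z ⟨t, h⟩ else 0

lemma continuous_extendBatches (t : ℕ) :
    Continuous fun z : Fin T → Fin k → Data din dout => extendBatches z t := by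
  unfold extendBatches
  split_ifs with h
  · exact continuous_apply _
  · exact continuous_const

/-- Parameters at time `T` see only the batches before `T`, so they are a function of the finite
family that is independent of the test sample. -/
lemma iterates_extendBatches (l : Loss dout) (σ : ℝ → ℝ) (lam : ℝ) (ηV ηW : ℕ → ℝ)
    (v₀ : Matrix (Fin din) (Fin d) ℝ) (w₀ : Matrix (Fin d) (Fin dout) ℝ)
    (z : ℕ → Fin k → Data din dout) :
    iterates l σ lam ηV ηW v₀ w₀ (extendBatches fun t : Fin T => z t) T =
      iterates l σ lam ηV ηW v₀ w₀ z T :=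
  iterates_congr T fun s hs => by rw [extendBatches, dif_pos hs]

variable {Ω : Type*} [MeasurableSpace Ω] {P : Measure Ω} {ρ : Measure (Data din dout)}

lemma ae_norm_batches_le_one (hρ : ρ.support ⊆ {z | max ‖z.1‖ ‖z.2‖ ≤ 1})
    {Ztr : ℕ → Fin k → Ω → Data din dout} (hZtr : ∀ t < T, IIDSample P ρ (Ztr t)) :
    ∀ᵐ ω ∂P, ∀ t < T, ∀ r, ‖(Ztr t r ω).1‖ ≤ 1 := by
  rw [ae_all_iff]
  intro t
  by_cases ht : t < T
  · simp only [ht, true_implies]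
    rw [ae_all_iff]
    intro r
    have h := ae_norm_le_one hρ
    rw [← (hZtr t ht).law r] at h
    filter_upwards [ae_of_ae_map ((hZtr t ht).measurable r).aemeasurable h] with ω hω
    exact hω.1
  · simp [ht]

end Training

lemma exp_neg_sq_sqrt_two_log {a ζ : ℝ} (hζ : 0 < ζ) (ha : ζ ≤ a) :
    Real.exp (-√(2 * Real.log (a / ζ)) ^ 2 / 2) = ζ / a := by
  have ha0 : 0 < a := hζ.trans_le ha
  have hL : 0 ≤ Real.log (a / ζ) := Real.log_nonneg ((one_le_div hζ).2 ha)
  rw [Real.sq_sqrt (by positivity), ← mul_neg, mul_div_cancel_left₀ _ two_ne_zero, ← Real.log_inv,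
    Real.exp_log (by positivity), inv_div]

lemma prod_one_sub_mem {T : ℕ} {η : ℕ → ℝ} {lam : ℝ} (hlam : 0 < lam)
    (hη : ∀ t < T, 0 ≤ η t ∧ η t ≤ 1 / lam) :
    0 ≤ ∏ t ∈ Finset.range T, (1 - η t * lam) ∧ ∏ t ∈ Finset.range T, (1 - η t * lam) ≤ 1 := by
  have h : ∀ t ∈ Finset.range T, 0 ≤ 1 - η t * lam ∧ 1 - η t * lam ≤ 1 := fun t ht => by
    obtain ⟨h0, h1⟩ := hη t (Finset.mem_range.1 ht)
    have := (le_div_iff₀ hlam).1 h1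
    exact ⟨by linarith, by linarith [mul_nonneg h0 hlam.le]⟩
  exact ⟨Finset.prod_nonneg fun t ht => (h t ht).1,
    Finset.prod_le_one (fun t ht => (h t ht).1) fun t ht => (h t ht).2⟩

lemma norm_mul_frob_le_C3 {din d dout k T : ℕ} (hk : 1 ≤ k) {l : Loss dout} {σ : ℝ → ℝ}
    (hl : AdmissibleLoss l) (hσ : AdmissibleActivation σ) {lam : ℝ} (hlam : 0 < lam)
    {ηV ηW : ℕ → ℝ} (hη : ∀ t < T, 0 ≤ ηV t ∧ ηV t ≤ 1 / lam) (hW : ∀ t < T, ηW t = 0)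
    {z : ℕ → Fin k → Data din dout} (hz : ∀ t < T, ∀ r, ‖(z t r).1‖ ≤ 1)
    {v : Matrix (Fin din) (Fin d) ℝ} {w : Matrix (Fin d) (Fin dout) ℝ} {ζ : ℝ}
    (hv : ‖v‖ ≤ √(kappa / d) * (√din + √d + √(2 * Real.log (4 / ζ)))) :
    ‖(iterates l σ lam ηV ηW v w z T).1‖ * ‖w‖ ≤ C3 din lam ηV w ζ T := by
  obtain ⟨h0, h1⟩ := prod_one_sub_mem hlam hη
  have h := norm_iterates_fst_le (v₀ := v) (w₀ := w) hk hl hσ hlam hη hz hW T le_rfl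
  set p := ∏ t ∈ Finset.range T, (1 - ηV t * lam) with hp
  have hf : 0 ≤ frob w := Real.sqrt_nonneg _
  have hwf := l2_opNorm_le_frob w
  calc _ ≤ (√(kappa / d) * (√din + √d + √(2 * Real.log (4 / ζ))) * p + frob w / lam * (1 - p))
        * frob w := by
        refine mul_le_mul (h.trans (add_le_add (mul_le_mul_of_nonneg_right hv h0)
          (mul_le_mul_of_nonneg_right ?_ (sub_nonneg.2 h1)))) hwf (norm_nonneg _) ?_
        · gcongr
        · have := sub_nonneg.2 h1
          positivity
    _ = _ := by
        rw [C3, ← hp]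
        ring

lemma norm_mul_norm_le_C5 {din d dout k T : ℕ} (hd : 1 ≤ d) (hdout : 1 ≤ dout) (hk : 1 ≤ k)
    {l : Loss dout} {σ : ℝ → ℝ}
    (hl : AdmissibleLoss l) (hσ : AdmissibleActivation σ) {lam : ℝ} (hlam : 0 < lam)
    {ηV ηW : ℕ → ℝ} (hη : ∀ t < T, 0 ≤ ηV t ∧ ηV t ≤ 1 / lam) (hW : ∀ t < T, ηW t = ηV t)
    {z : ℕ → Fin k → Data din dout} (hz : ∀ t < T, ∀ r, ‖(z t r).1‖ ≤ 1)
    {v : Matrix (Fin din) (Fin d) ℝ} {w : Matrix (Fin d) (Fin dout) ℝ} {ζ : ℝ}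
    (hζ0 : 0 < ζ) (hζ1 : ζ < 1)
    (hv : ‖v‖ ≤ √(kappa / d) * (√din + √d + √(2 * Real.log (8 / ζ))))
    (hw : ‖w‖ ≤ √(kappa / dout) * (√d + √dout + √(2 * Real.log (8 / ζ)))) :
    ‖(iterates l σ lam ηV ηW v w z T).1‖ * ‖(iterates l σ lam ηV ηW v w z T).2‖ ≤
      C5 din d dout lam ηV ζ T := by
  have h := norm_iterates_add_le (v₀ := v) (w₀ := w) hk hl hσ hlam hη hz hW T le_rfl
  set p := ∏ t ∈ Finset.range T, (1 + (1 - lam) * ηV t) with hp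
  set a := ‖(iterates l σ lam ηV ηW v w z T).1‖
  set b := ‖(iterates l σ lam ηV ηW v w z T).2‖
  set L := Real.log (8 / ζ) with hLdef
  have hL : 0 ≤ L := Real.log_nonneg (by rw [le_div_iff₀ hζ0]; linarith)
  have hd0 : (0 : ℝ) < d := by positivity
  have hdo : (0 : ℝ) < dout := by positivity
  have hκ : (kappa : ℝ) = 2 := rfl
  -- Source of the factor `3` in `C5`: the initial norm bounds are sums of three square roots.
  have hsq3 : ∀ x y z : ℝ, (x + y + z) ^ 2 ≤ 3 * (x ^ 2 + y ^ 2 + z ^ 2) := fun x y z => by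
    nlinarith [sq_nonneg (x - y), sq_nonneg (y - z), sq_nonneg (x - z)]
  have hv2 : ‖v‖ ^ 2 ≤ 2 / d * (3 * (din + d + 2 * L)) := by
    refine (pow_le_pow_left₀ (norm_nonneg _) hv 2).trans ?_
    rw [mul_pow, Real.sq_sqrt (by positivity), hκ]
    refine mul_le_mul_of_nonneg_left ((hsq3 _ _ _).trans_eq ?_) (by positivity)
    rw [Real.sq_sqrt (by positivity), Real.sq_sqrt (by positivity), Real.sq_sqrt (by positivity)]
  have hw2 : ‖w‖ ^ 2 ≤ 2 / dout * (3 * (d + dout + 2 * L)) := by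
    refine (pow_le_pow_left₀ (norm_nonneg _) hw 2).trans ?_
    rw [mul_pow, Real.sq_sqrt (by positivity), hκ]
    refine mul_le_mul_of_nonneg_left ((hsq3 _ _ _).trans_eq ?_) (by positivity)
    rw [Real.sq_sqrt (by positivity), Real.sq_sqrt (by positivity), Real.sq_sqrt (by positivity)]
  -- `4 * a * b ≤ (a + b) ^ 2 ≤ 2 * (‖v‖ ^ 2 + ‖w‖ ^ 2) * p ^ 2`, which even leaves a factor two to
  -- spare.
  have hab : a * b ≤ (‖v‖ ^ 2 + ‖w‖ ^ 2) * p ^ 2 := by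
    have h1 : (a + b) ^ 2 ≤ ((‖v‖ + ‖w‖) * p) ^ 2 :=
      pow_le_pow_left₀ (add_nonneg (norm_nonneg _) (norm_nonneg _)) h 2
    rw [mul_pow] at h1
    have h2 : (‖v‖ + ‖w‖) ^ 2 * p ^ 2 ≤ 2 * (‖v‖ ^ 2 + ‖w‖ ^ 2) * p ^ 2 := by
      gcongr
      nlinarith [sq_nonneg (‖v‖ - ‖w‖)]
    nlinarith [sq_nonneg (a - b), mul_nonneg (add_nonneg (sq_nonneg ‖v‖) (sq_nonneg ‖w‖)) (sq_nonneg p)]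
  refine hab.trans ((mul_le_mul_of_nonneg_right (add_le_add hv2 hw2) (sq_nonneg p)).trans_eq ?_)
  rw [C5, hκ, Finset.prod_pow, ← hp, ← hLdef]
  congr 1
  field_simp
  ring

end SGM

open SGM in
theorem mainTheorem3
    (din d dout n k T : ℕ) (hdin : 1 ≤ din) (hd : 1 ≤ d) (hdout : 1 ≤ dout)
    (hn : 1 ≤ n) (hk : 1 ≤ k)
    (ρ : Measure (SGM.Data din dout)) [IsProbabilityMeasure ρ]
    (hρ : ρ.support ⊆ {z | max ‖z.1‖ ‖z.2‖ ≤ 1})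
    (l : SGM.Loss dout) (hl : SGM.AdmissibleLoss l)
    (σ : ℝ → ℝ) (hσ : SGM.AdmissibleActivation σ)
    (lam : ℝ) (hlam : 0 < lam)
    (ηV ηW : ℕ → ℝ) (hη : ∀ t < T, 0 ≤ ηW t ∧ ηW t ≤ ηV t ∧ ηV t ≤ 1 / lam)
    {Ω : Type*} [MeasurableSpace Ω] (P : Measure Ω) [IsProbabilityMeasure P]
    -- the test sample
    (Z : Fin n → Ω → SGM.Data din dout) (hZ : SGM.IIDSample P ρ Z)
    -- the training batches
    (Ztr : ℕ → Fin k → Ω → SGM.Data din dout) (hZtr : ∀ t < T, SGM.IIDSample P ρ (Ztr t))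
    (V₀ : Ω → Matrix (Fin din) (Fin d) ℝ) :
    -- frozen second layer
    (∀ w : Matrix (Fin d) (Fin dout) ℝ,
      SGM.HeInitFirst P V₀ →
      IndepFun (fun ω i => Z i ω)
        (fun ω => ((fun i j => V₀ ω i j : Fin din → Fin d → ℝ),
          (fun t i => Ztr t i ω : Fin T → Fin k → SGM.Data din dout))) P →
      (∀ t < T, ηW t = 0) →
      ∀ ζ : ℝ, 0 < ζ → ζ < 1 →
        1 - ζ ≤ P.real {ω |
          |SGM.genError ρ l σ (fun i => Z i ω)
            (SGM.iterates l σ lam ηV ηW (V₀ ω) w (fun t i => Ztr t i ω) T).1 w|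
          ≤ (1 + SGM.C3 din lam ηV w ζ T) * Real.sqrt (2 / n * Real.log (4 / ζ))}) ∧
    -- equal learning rates
    (∀ W₀ : Ω → Matrix (Fin d) (Fin dout) ℝ,
      SGM.HeInit P V₀ W₀ →
      IndepFun (fun ω i => Z i ω)
        (fun ω => ((fun i j => V₀ ω i j : Fin din → Fin d → ℝ),
          (fun i j => W₀ ω i j : Fin d → Fin dout → ℝ),
          (fun t i => Ztr t i ω : Fin T → Fin k → SGM.Data din dout))) P →
      (∀ t < T, ηW t = ηV t) →
      ∀ ζ : ℝ, 0 < ζ → ζ < 1 →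
        1 - ζ ≤ P.real {ω |
          |SGM.genError ρ l σ (fun i => Z i ω)
            (SGM.iterates l σ lam ηV ηW (V₀ ω) (W₀ ω) (fun t i => Ztr t i ω) T).1
            (SGM.iterates l σ lam ηV ηW (V₀ ω) (W₀ ω) (fun t i => Ztr t i ω) T).2|
          ≤ (1 + SGM.C5 din d dout lam ηV ζ T) * Real.sqrt (2 / n * Real.log (4 / ζ))}) := by
  have hηV : ∀ t < T, 0 ≤ ηV t ∧ ηV t ≤ 1 / lam := fun t ht =>
    ⟨(hη t ht).1.trans (hη t ht).2.1, (hη t ht).2.2⟩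
  have hd0 : (d : ℝ≥0) ≠ 0 := by simpa using Nat.one_le_iff_ne_zero.1 hd
  have hdo0 : (dout : ℝ≥0) ≠ 0 := by simpa using Nat.one_le_iff_ne_zero.1 hdout
  have hκ0 : kappa ≠ 0 := two_ne_zero
  have hball := ae_norm_batches_le_one hρ hZtr
  have hZm : ∀ t : Fin T, ∀ i, Measurable (Ztr t i) := fun t i => (hZtr t t.2).measurable i
  refine ⟨fun w hV hind hW ζ hζ0 hζ1 => ?_, fun W₀ hVW hind hW ζ hζ0 hζ1 => ?_⟩
  · set Φ : (Fin din → Fin d → ℝ) × (Fin T → Fin k → SGM.Data din dout) →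
        (Fin din → Fin d → ℝ) × (Fin d → Fin dout → ℝ) := fun q =>
      (Matrix.of.symm (iterates l σ lam ηV ηW (Matrix.of q.1) w (extendBatches q.2) T).1,
        Matrix.of.symm w) with hΦ
    have hΦc : Continuous Φ := by
      have h := continuous_iterates (X := (Fin din → Fin d → ℝ) ×
        (Fin T → Fin k → SGM.Data din dout)) hk hl hσ lam ηV ηW
        (z := fun q => extendBatches q.2) (v := fun q => Matrix.of q.1) (w := fun _ => w)
        (fun t => (continuous_extendBatches t).comp continuous_snd) continuous_fst
        continuous_const T
      exact h.fst.prodMk continuous_const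
    have hqm : Measurable fun ω => ((fun i j => V₀ ω i j : Fin din → Fin d → ℝ),
        (fun t i => Ztr t i ω : Fin T → Fin k → SGM.Data din dout)) :=
      (measurable_pi_lambda _ fun i => measurable_pi_lambda _ fun j => hV.measurable (i, j)).prodMk
        (measurable_pi_lambda _ fun t => measurable_pi_lambda _ fun i => hZm t i)
    refine one_sub_le_prob_genError_le hρ hn hl hσ hZ (W := fun _ => w)
      (hΦc.measurable.comp hqm) (hind.comp measurable_id hΦc.measurable) (fun ω => ?_) ?_ hζ0 hζ1
    · have h := congrArg Prod.fst (iterates_extendBatches (T := T) l σ lam ηV ηW (V₀ ω) w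
        fun t i => Ztr t i ω)
      exact Prod.ext h rfl
    · have hs : 0 < √(2 * Real.log (4 / ζ)) :=
        Real.sqrt_pos.2 (mul_pos two_pos (Real.log_pos (by rw [lt_div_iff₀ hζ0]; linarith)))
      have htail := measure_l2_opNorm_gt_le hdin hd (div_ne_zero hκ0 hd0) hV hs
      rw [exp_neg_sq_sqrt_two_log hζ0 (by linarith)] at htail
      -- The inputs have norm at most one only almost surely, so the inclusion of events is almost
      -- sure. The Gaussian tail is `ζ / 4`, below the allowed `ζ / 2`.
      refine (measure_mono_ae ?_).trans (htail.trans (ENNReal.ofReal_le_ofReal (by linarith)))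
      filter_upwards [hball] with ω hω hgt
      by_contra hcon
      refine not_le.2 hgt (norm_mul_frob_le_C3 hk hl hσ hlam hηV hW hω ?_)
      have := not_lt.1 hcon
      simpa using this
  · set Φ : (Fin din → Fin d → ℝ) × (Fin d → Fin dout → ℝ) ×
        (Fin T → Fin k → SGM.Data din dout) →
        (Fin din → Fin d → ℝ) × (Fin d → Fin dout → ℝ) := fun q =>
      (Matrix.of.symm (iterates l σ lam ηV ηW (Matrix.of q.1) (Matrix.of q.2.1)
          (extendBatches q.2.2) T).1,
        Matrix.of.symm (iterates l σ lam ηV ηW (Matrix.of q.1) (Matrix.of q.2.1)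
          (extendBatches q.2.2) T).2) with hΦ
    have hΦc : Continuous Φ :=
      continuous_iterates (X := (Fin din → Fin d → ℝ) × (Fin d → Fin dout → ℝ) ×
        (Fin T → Fin k → SGM.Data din dout)) hk hl hσ lam ηV ηW
        (z := fun q => extendBatches q.2.2) (v := fun q => Matrix.of q.1)
        (w := fun q => Matrix.of q.2.1)
        (fun t => (continuous_extendBatches t).comp continuous_snd.snd) continuous_fst
        continuous_snd.fst T
    have hqm : Measurable fun ω => ((fun i j => V₀ ω i j : Fin din → Fin d → ℝ),
        (fun i j => W₀ ω i j : Fin d → Fin dout → ℝ),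
        (fun t i => Ztr t i ω : Fin T → Fin k → SGM.Data din dout)) :=
      (measurable_pi_lambda _ fun i => measurable_pi_lambda _ fun j =>
        hVW.measurable (.inl (i, j))).prodMk
        ((measurable_pi_lambda _ fun i => measurable_pi_lambda _ fun j =>
          hVW.measurable (.inr (i, j))).prodMk
        (measurable_pi_lambda _ fun t => measurable_pi_lambda _ fun i => hZm t i))
    have : OpensMeasurableSpace ((Fin d → Fin dout → ℝ) ×
        (Fin T → Fin k → SGM.Data din dout)) := inferInstance
    have : OpensMeasurableSpace ((Fin din → Fin d → ℝ) × (Fin d → Fin dout → ℝ) ×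
        (Fin T → Fin k → SGM.Data din dout)) := Prod.opensMeasurableSpace
    refine one_sub_le_prob_genError_le hρ hn hl hσ hZ
      (hΦc.measurable.comp hqm) (hind.comp measurable_id hΦc.measurable) (fun ω => ?_) ?_ hζ0 hζ1
    · have h := iterates_extendBatches (T := T) l σ lam ηV ηW (V₀ ω) (W₀ ω)
        fun t i => Ztr t i ω
      have h1 := congrArg Prod.fst h
      have h2 := congrArg Prod.snd h
      exact Prod.ext h1 h2
    · have hs : 0 < √(2 * Real.log (8 / ζ)) :=
        Real.sqrt_pos.2 (mul_pos two_pos (Real.log_pos (by rw [lt_div_iff₀ hζ0]; linarith)))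
      have hV : IndepCenteredGaussians P (fun _ : Fin din × Fin d => kappa / (d : ℝ≥0))
          fun q ω => V₀ ω q.1 q.2 :=
        ⟨fun q => hVW.measurable (.inl q), fun q => hVW.law (.inl q),
          hVW.indep.precomp Sum.inl_injective⟩
      have hW₀ : IndepCenteredGaussians P (fun _ : Fin d × Fin dout => kappa / (dout : ℝ≥0))
          fun q ω => W₀ ω q.1 q.2 :=
        ⟨fun q => hVW.measurable (.inr q), fun q => hVW.law (.inr q),
          hVW.indep.precomp Sum.inr_injective⟩
      have htV := measure_l2_opNorm_gt_le hdin hd (div_ne_zero hκ0 hd0) hV hs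
      have htW := measure_l2_opNorm_gt_le hd hdout (div_ne_zero hκ0 hdo0) hW₀ hs
      rw [exp_neg_sq_sqrt_two_log hζ0 (by linarith)] at htV htW
      -- With `log (8 / ζ)` each of the two matrices fails with probability at most `ζ / 8`, and the
      -- union costs `ζ / 4`.
      refine (measure_mono_ae ?_).trans ((measure_union_le _ _).trans ((add_le_add htV htW).trans ?_))
      · filter_upwards [hball] with ω hω hgt
        by_contra hcon
        obtain ⟨h1, h2⟩ := not_or.1 hcon
        refine not_le.2 hgt (norm_mul_norm_le_C5 hd hdout hk hl hσ hlam hηV hW hω hζ0 hζ1 ?_ ?_)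
        · by_contra hc
          refine h1 (lt_of_eq_of_lt ?_ (not_le.1 hc))
          rw [NNReal.coe_div, NNReal.coe_natCast]
        · by_contra hc
          refine h2 (lt_of_eq_of_lt ?_ (not_le.1 hc))
          rw [NNReal.coe_div, NNReal.coe_natCast]
      · rw [← ENNReal.ofReal_add (by positivity) (by positivity)]
        exact ENNReal.ofReal_le_ofReal (by linarith)
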